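/- Let $d\ge 1$ be an integer and let $L,\beta,\alpha>0$. Let $c_0,r_0,C_0,\mu_{\max}>0$ and let $\mathcal C\subset\mathbb R^d$ be compact. Definitions. Let $\mathcal Z=\mathbb R^d\times\{0,1\}$. For a probability distribution $P$ of $(X,Y)$ on $\mathcal Z$, let $P_X$ be the marginal law of $X$, $\eta(x)=P(Y=1\mid X=x)$ the regression function, $R(f)=P(Y\ne f(X))$ the risk of a Borel decision rule $f:\mathbb R^d\to\{0,1\}$, and $f^*=\mathbf 1_{\{\eta\ge 1/2\}}$ the Bayes rule. Let $\lambda$ be Lebesgue measure and $\mathcal B(x,r)$ the closed Euclidean ball. A Lebesgue measurable set $A\subset\mathbb R^d$ is $(c_0,r_0)$-regular if $\lambda(A\cap\mathcal B(x,r))\ge c_0\,\lambda(\mathcal B(x,r))$ for all $x\in A$ and $0<r\le r_0$. Let $\lfloor\beta\rfloor$ be the largest integer strictly less than $\beta$. The Hölder class $\Sigma(\beta,L,\mathbb R^d)$ consists of the $\lfloor\beta\rfloor$ times continuously differentiable $g:\mathbb R^d\to\mathbb R$ with $|g(x')-g_x(x')|\le L\|x-x'\|^\beta$ for all $x,x'$,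 where $g_x$ is the Taylor polynomial of $g$ of degree $\lfloor\beta\rfloor$ at $x$. Let $\mathcal P'_\Sigma$ be the class of all probability distributions $P$ on $\mathcal Z$ such that (i) $P_X(0<|\eta(X)-1/2|\le t)\le C_0t^\alpha$ for all $t>0$; (ii) $\eta$ has a $[0,1]$-valued version that belongs to $\Sigma(\beta,L,\mathbb R^d)$; (iii) (mild density assumption) $P_X$ is supported on (that is, gives full mass to) some compact $(c_0,r_0)$-regular set $A\subseteq\mathcal C$ and has a Lebesgue density $\mu$ with $\mu(x)\le\mu_{\max}$ for all $x\in A$. A classifier $\hat f_n$ based on an i.i.d. sample of size $n$ from $P$ is a map from $\mathcal Z^n$ to decision rules for which $(z,x)\mapsto\hat f_n(z)(x)$ is measurable; $\mathbb E$ is the expectation over the sample. Theorem. Assume that $\mathcal C$ contains a compact $(c_0,r_0)$-regular set $A$ with $\mu_{\max}\,\lambda(A)>1$. Then there is a constant $C>0$ such that for every $n\ge1$ and every classifier $\hat f_n$, $$\sup_{P\in\mathcal P'_\Sigma}\bigl\{\mathbb E R(\hat f_n)-R(f^*)\bigr\}\ \ge\ C\,n^{-\frac{(1+\alpha)\beta}{(2+\alpha)\beta+d}}.$$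 In particular the rate $n^{-1}$, and hence any super-fast rate, is impossible over $\mathcal P'_\Sigma$: for every $M$ there is $n_0$ such that for all $n\ge n_0$ and all classifiers $\hat f_n$, $\sup_{P\in\mathcal P'_\Sigma}\{\mathbb E R(\hat f_n)-R(f^*)\}> M/n$. -/

import Mathlib

open MeasureTheory ProbabilityTheory Filter
open scoped ENNReal

namespace PlugIn

noncomputable section

/-- The feature space `ℝ^d` with its Euclidean norm. -/
abbrev Feat (d : ℕ) : Type := EuclideanSpace ℝ (Fin d)

/-- The observation space `𝒵 = ℝ^d × {0,1}`. -/
abbrev Obs (d : ℕ) : Type := Feat d × Fin 2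

/-! ### Hölder classes -/

/-- For `β > 0`, the largest integer strictly less than `β`. -/
def strictFloor (β : ℝ) : ℕ := ⌈β⌉₊ - 1

/-- The Taylor polynomial of degree `l` of `g` at `x`, evaluated at `x'`. The `k`-th term
`D^k g(x)(x' - x, …, x' - x) / k!` is the sum of `(x' - x)^s / s! * D^s g(x)` over all
multi-indices `s` with `|s| = k`. -/
def taylorPoly {d : ℕ} (l : ℕ) (g : Feat d → ℝ) (x x' : Feat d) : ℝ :=
  ∑ k ∈ Finset.range (l + 1),
    ((k.factorial : ℝ))⁻¹ * iteratedFDeriv ℝ k g x (fun _ => x' - x)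

/-- The Hölder class `Σ(β, L, ℝ^d)`. -/
def HolderClass (d : ℕ) (β L : ℝ) : Set (Feat d → ℝ) :=
  {g | ContDiff ℝ (strictFloor β : ℕ) g ∧
    ∀ x x' : Feat d, |g x' - taylorPoly (strictFloor β) g x x'| ≤ L * ‖x - x'‖ ^ β}

/-! ### Distributions of `(X, Y)` -/

/-- The marginal distribution `P_X`. -/
def marginalX {d : ℕ} (P : ProbabilityMeasure (Obs d)) : Measure (Feat d) :=
  (P : Measure (Obs d)).fst

/-- The regression function `η(x) = P(Y = 1 | X = x)`, computed from the regular conditional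
distribution of `Y` given `X` under `P`. -/
def regression {d : ℕ} (P : ProbabilityMeasure (Obs d)) (x : Feat d) : ℝ :=
  ((P : Measure (Obs d)).condKernel x).real {1}

/-- The Bayes rule `f*(x) = 1` if `η(x) ≥ 1/2`, and `f*(x) = 0` otherwise. -/
def bayesRule {d : ℕ} (P : ProbabilityMeasure (Obs d)) (x : Feat d) : Fin 2 :=
  open Classical in if 1 / 2 ≤ regression P x then 1 else 0

/-- The misclassification risk `R(f) = P(Y ≠ f(X))`. -/
def risk {d : ℕ} (P : ProbabilityMeasure (Obs d)) (f : Feat d → Fin 2) : ℝ :=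
  (P : Measure (Obs d)).real {z | z.2 ≠ f z.1}

/-- The margin assumption (MA):
`P_X(0 < |η(X) - 1/2| ≤ t) ≤ C₀ t^α` for all `t > 0`. -/
def MarginAssumption {d : ℕ} (α C₀ : ℝ) (P : ProbabilityMeasure (Obs d)) : Prop :=
  ∀ t : ℝ, 0 < t →
    (marginalX P).real {x | 0 < |regression P x - 1 / 2| ∧ |regression P x - 1 / 2| ≤ t}
      ≤ C₀ * t ^ α

/-- The regression function belongs to `Σ(β, L, ℝ^d)`: as it is determined by `P` only up to
`P_X`-null sets, this means that some version of it, with values in `[0,1]`, is in the class. -/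
def RegressionHolder {d : ℕ} (β L : ℝ) (P : ProbabilityMeasure (Obs d)) : Prop :=
  ∃ g ∈ HolderClass d β L, (∀ x, g x ∈ Set.Icc (0 : ℝ) 1) ∧ g =ᵐ[marginalX P] regression P

/-- `(c₀, r₀)`-regular subsets of `ℝ^d`. -/
def IsRegularSet {d : ℕ} (c₀ r₀ : ℝ) (A : Set (Feat d)) : Prop :=
  NullMeasurableSet A volume ∧
    ∀ x ∈ A, ∀ r : ℝ, 0 < r → r ≤ r₀ →
      ENNReal.ofReal c₀ * volume (Metric.closedBall x r) ≤ volume (A ∩ Metric.closedBall x r)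

/-- The mild density assumption: `P_X` is supported on a compact `(c₀, r₀)`-regular set `A ⊆ K`
and has a Lebesgue density that is at most `μmax` on `A`. -/
def MildDensity {d : ℕ} (c₀ r₀ μmax : ℝ) (K : Set (Feat d))
    (P : ProbabilityMeasure (Obs d)) : Prop :=
  ∃ A ⊆ K, IsCompact A ∧ IsRegularSet c₀ r₀ A ∧ marginalX P Aᶜ = 0 ∧
    ∃ μ : Feat d → ℝ, Measurable μ ∧ (∀ x, 0 ≤ μ x) ∧
      marginalX P = volume.withDensity (fun x => ENNReal.ofReal (μ x)) ∧
      ∀ x ∈ A, μ x ≤ μmax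

/-- The class `𝒫'_Σ`. -/
def MildClass (d : ℕ) (α C₀ β L c₀ r₀ μmax : ℝ) (K : Set (Feat d)) :
    Set (ProbabilityMeasure (Obs d)) :=
  {P | MarginAssumption α C₀ P ∧ RegressionHolder β L P ∧ MildDensity c₀ r₀ μmax K P}

/-! ### Classifiers -/

/-- A classifier based on a sample of size `n`: it maps a sample to a decision rule
`ℝ^d → {0,1}`, and the decision depends measurably on the sample and the point. -/
def IsClassifier {d n : ℕ} (f : (Fin n → Obs d) → Feat d → Fin 2) : Prop :=
  Measurable (fun p : (Fin n → Obs d) × Feat d => f p.1 p.2)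

/-- The excess risk `𝔼 R(f) - R(f*)` of the classifier `f`, the sample being i.i.d. from `P`. -/
def excessRisk {d n : ℕ} (P : ProbabilityMeasure (Obs d))
    (f : (Fin n → Obs d) → Feat d → Fin 2) : ℝ :=
  (∫ z, risk P (f z) ∂(Measure.pi fun _ : Fin n => (P : Measure (Obs d))))
    - risk P (bayesRule P)

/-- The worst-case excess risk of `f` over a class `Q` of distributions. -/
def worstExcessRisk {d n : ℕ} (Q : Set (ProbabilityMeasure (Obs d)))
    (f : (Fin n → Obs d) → Feat d → Fin 2) : EReal :=
  ⨆ P ∈ Q, ((excessRisk P f : ℝ) : EReal)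

end

end PlugIn

namespace PlugIn

/-! ### Taylor expansions and Hölder classes -/

section Taylor

variable {d : ℕ}

/-! The proof is Assouad's hypercube argument at a scale `r` of order `n ^ (-1/D)`, `D = (2+α)β +
d`. In a small ball about a point of `A`, regularity provides `m ≳ r^(-d)` points of `A` that are
`4r`-separated; the cells are the intersections of `A` with the `r`-balls about them. On cell `j`
the regression function is `1/2 + σ j * b` with `σ j = ±1` and `b = a r^β`, the largest order of
amplitude that rescaled bumps of width `r` may have in the Hölder class. The marginal gives each
cell mass `w` and puts the remaining mass on a far part of `A`, where the regression function is
`1/2`. It charges nothing else, in particular not the shells where the bumps decay, so `|η - 1/2|`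
takes only the values `0` and `b` almost surely.

The margin assumption then reduces to `m w ≤ C₀ b^α`, and the choice is `m w = κ b^α`. Thus `w` is
of order `r^(αβ+d)`, far below what the density bound allows. A strong density assumption would
forbid such thin marginals; the mild one does not, hence no restriction relating `α`, `β` and `d`.

Flipping one sign perturbs the law of one observation by a chi-square amount of order `b² w`, that
is `r^D`. With `n r^D ≤ 1` the sample cannot identify the sign, and averaged over all signs each
cell costs at least `2b * w/4`. Summing over the cells gives `κ/2 * b^(1+α)`, which has the claimed
order.

The carrying lemmas are `integral_sub_integral_perturbed_le` (two-point comparison),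
`exists_le_excessRisk_cellFun` (Assouad), `IsRegularSet.exists_packing` and
`IsRegularSet.exists_marginal` (geometry), and `le_worstExcessRisk_of_scale` (assembly). -/

lemma iteratedDeriv_comp_line {G : Feat d → ℝ} {k : ℕ} (hG : ContDiff ℝ k G) (x h : Feat d)
    (t : ℝ) :
    iteratedDeriv k (fun t : ℝ => G (x + t • h)) t
      = iteratedFDeriv ℝ k G (x + t • h) (fun _ => h) := by
  have hx : ContDiff ℝ k (fun y => G (x + y)) := hG.comp (contDiff_const.add contDiff_id)
  have h1 := (ContinuousLinearMap.toSpanSingleton ℝ h).iteratedFDeriv_comp_right hx t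
    (i := k) le_rfl
  rw [iteratedFDeriv_comp_add_left] at h1
  rw [iteratedDeriv_eq_iteratedFDeriv]
  have h2 : (fun t : ℝ => G (x + t • h))
      = (fun y => G (x + y)) ∘ (ContinuousLinearMap.toSpanSingleton ℝ h) := by
    ext t; simp
  rw [h2, h1]
  simp

lemma abs_iteratedFDeriv_diag_le {G : Feat d → ℝ} {k : ℕ} {M : ℝ} {x : Feat d}
    (hM : ‖iteratedFDeriv ℝ k G x‖ ≤ M) (h : Feat d) :
    |iteratedFDeriv ℝ k G x (fun _ => h)| ≤ M * ‖h‖ ^ k := by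
  have h1 := (iteratedFDeriv ℝ k G x).le_opNorm (fun _ => h)
  simp only [Finset.prod_const, Finset.card_univ, Fintype.card_fin] at h1
  exact h1.trans (by gcongr)

/-- Lagrange's remainder for the restriction of `G` to the line through `x` and `x'`; the factorial
in it is simply discarded. -/
lemma abs_sub_taylorPoly_le {G : Feat d → ℝ} {l : ℕ} {M : ℝ} (hG : ContDiff ℝ (l + 1 : ℕ) G)
    (hM : ∀ y, ‖iteratedFDeriv ℝ (l + 1) G y‖ ≤ M) (x x' : Feat d) :
    |G x' - taylorPoly l G x x'| ≤ M * ‖x - x'‖ ^ (l + 1) := by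
  set h := x' - x with hh
  have hnorm : ‖x - x'‖ = ‖h‖ := norm_sub_rev _ _
  set φ : ℝ → ℝ := fun t => G (x + t • h) with hφ
  have hφc : ContDiff ℝ (l + 1 : ℕ) φ :=
    hG.comp (contDiff_const.add (contDiff_id.smul contDiff_const))
  obtain ⟨t, -, ht⟩ := taylor_mean_remainder_lagrange_iteratedDeriv (f := φ) (n := l)
    (zero_ne_one : (0 : ℝ) ≠ 1) (by exact_mod_cast hφc.contDiffOn)
  have hT : taylorWithinEval φ l (Set.uIcc 0 1) 0 1 = taylorPoly l G x x' := by
    rw [taylor_within_apply, taylorPoly]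
    refine Finset.sum_congr rfl fun k hk => ?_
    have hkl : (k : WithTop ℕ∞) ≤ (l + 1 : ℕ) := by
      exact_mod_cast (Finset.mem_range.1 hk).le
    rw [iteratedDerivWithin_eq_iteratedDeriv (uniqueDiffOn_uIcc zero_ne_one)
      (hφc.of_le hkl).contDiffAt (by simp), iteratedDeriv_comp_line (hG.of_le hkl)]
    simp [hh]
  rw [hT, iteratedDeriv_comp_line hG] at ht
  have h1 : φ 1 = G x' := by simp [hφ, hh]
  rw [h1] at ht
  rw [ht, hnorm]
  have h2 := abs_iteratedFDeriv_diag_le (hM (x + t • h)) h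
  have h3 : (1 : ℝ) ≤ (l + 1).factorial := by exact_mod_cast (l + 1).factorial_pos
  rw [abs_div, sub_zero, one_pow, mul_one, Nat.abs_cast]
  exact (div_le_self (abs_nonneg _) h3).trans h2

lemma strictFloor_lt {β : ℝ} (hβ : 0 < β) : (strictFloor β : ℝ) < β := by
  -- As `β > 0` the ceiling is at least `1`, so the truncated subtraction in `strictFloor` is exact.
  have h1 : 0 < ⌈β⌉₊ := Nat.ceil_pos.2 hβ
  rw [strictFloor, Nat.cast_pred h1]
  linarith [Nat.ceil_lt_add_one hβ.le]

lemma le_strictFloor_add_one {β : ℝ} (hβ : 0 < β) : β ≤ strictFloor β + 1 := by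
  have h1 : 0 < ⌈β⌉₊ := Nat.ceil_pos.2 hβ
  rw [strictFloor, Nat.cast_pred h1]
  linarith [Nat.le_ceil β]

/-- At distance at most `1` the remainder has order `l + 1 ≥ β`. At larger distance no cancellation
is needed: `G x'` and the `l + 1` Taylor terms are bounded one by one, all exponents being at most
`l < β`; this is the constant `l + 2`. -/
lemma abs_sub_taylorPoly_le_rpow {G : Feat d → ℝ} {β M : ℝ} (hβ : 0 < β)
    (hG : ContDiff ℝ (strictFloor β + 1 : ℕ) G)
    (hM : ∀ k ≤ strictFloor β + 1, ∀ y, ‖iteratedFDeriv ℝ k G y‖ ≤ M) (x x' : Feat d) :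
    |G x' - taylorPoly (strictFloor β) G x x'| ≤ (strictFloor β + 2) * M * ‖x - x'‖ ^ β := by
  set l := strictFloor β with hl
  have hM0 : 0 ≤ M := (norm_nonneg _).trans (hM 0 (by omega) 0)
  have hl0 : (0 : ℝ) ≤ l := Nat.cast_nonneg _
  rcases le_or_gt ‖x - x'‖ 1 with hle | hgt
  · have h1 := abs_sub_taylorPoly_le hG (hM (l + 1) le_rfl) x x'
    have h2 : ‖x - x'‖ ^ (l + 1) ≤ ‖x - x'‖ ^ β := by
      rw [← Real.rpow_natCast]
      refine Real.rpow_le_rpow_of_exponent_ge_of_imp (norm_nonneg _) hle ?_ ?_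
      · push_cast; exact le_strictFloor_add_one hβ
      · intro _ h0; exact absurd h0 (by positivity)
    calc _ ≤ M * ‖x - x'‖ ^ β := h1.trans (by gcongr)
      _ = 1 * M * ‖x - x'‖ ^ β := by ring
      _ ≤ _ := by gcongr; linarith
  · have hpow : ∀ k ≤ l, ‖x - x'‖ ^ k ≤ ‖x - x'‖ ^ β := fun k hk => by
      rw [← Real.rpow_natCast]
      refine Real.rpow_le_rpow_of_exponent_le hgt.le ?_
      exact (Nat.cast_le.2 hk).trans (strictFloor_lt hβ).le
    have h0 : |G x'| ≤ M * ‖x - x'‖ ^ β := by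
      have h1 := hM 0 (by omega) x'
      rw [norm_iteratedFDeriv_zero, Real.norm_eq_abs] at h1
      calc |G x'| ≤ M * 1 := by linarith
        _ ≤ _ := by gcongr; simpa using hpow 0 (by omega)
    have hT : |taylorPoly l G x x'| ≤ (l + 1) * (M * ‖x - x'‖ ^ β) := by
      rw [taylorPoly]
      refine (Finset.abs_sum_le_sum_abs _ _).trans ?_
      calc _ ≤ ∑ k ∈ Finset.range (l + 1), M * ‖x - x'‖ ^ β := by
            refine Finset.sum_le_sum fun k hk => ?_
            have hk' : k ≤ l := Nat.lt_succ_iff.1 (Finset.mem_range.1 hk)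
            have h1 := abs_iteratedFDeriv_diag_le (hM k (by omega) x) (x' - x)
            rw [norm_sub_rev] at h1
            have h3 : (1 : ℝ) ≤ k.factorial := by exact_mod_cast k.factorial_pos
            rw [abs_mul, abs_inv, Nat.abs_cast]
            calc _ ≤ 1 * (M * ‖x - x'‖ ^ k) := by
                  gcongr
                  exact inv_le_one_of_one_le₀ h3
              _ ≤ _ := by rw [one_mul]; gcongr; exact hpow k hk'
        _ = _ := by simp
    calc _ ≤ |G x'| + |taylorPoly l G x x'| := abs_sub _ _
      _ ≤ _ := by linarith

lemma taylorPoly_const_add_mul_comp_smul {G : Feat d → ℝ} {l : ℕ} (hG : ContDiff ℝ l G)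
    (c b s : ℝ) (x x' : Feat d) :
    taylorPoly l (fun y => c + b * G (s • y)) x x'
      = c + b * taylorPoly l G (s • x) (s • x') := by
  simp only [taylorPoly]
  have key : ∀ k ≤ l, iteratedFDeriv ℝ k (fun y => c + b * G (s • y)) x
      = iteratedFDeriv ℝ k (fun _ => c) x + b • s ^ k • iteratedFDeriv ℝ k G (s • x) := by
    intro k hk
    have hGk : ContDiff ℝ k G := hG.of_le (by exact_mod_cast hk)
    have hs : ContDiff ℝ k (fun y => G (s • y)) := hGk.comp (contDiff_const_smul s)
    have h1 : (fun y => c + b * G (s • y)) = (fun _ => c) + b • (fun y => G (s • y)) := by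
      ext y; simp
    rw [h1, iteratedFDeriv_add_apply (g := b • fun y => G (s • y)) contDiffAt_const
      (contDiffAt_const.smul hs.contDiffAt),
      iteratedFDeriv_const_smul_apply hs.contDiffAt, iteratedFDeriv_comp_const_smul s hGk]
  have hd : ∀ k, iteratedFDeriv ℝ k G (s • x) (fun _ => s • x' - s • x)
      = s ^ k * iteratedFDeriv ℝ k G (s • x) (fun _ => x' - x) := by
    intro k
    have := (iteratedFDeriv ℝ k G (s • x)).map_smul_univ (fun _ => s) (fun _ => x' - x)
    simpa [smul_sub] using this
  have hc : ∀ k ∈ Finset.range (l + 1), ((k.factorial : ℝ))⁻¹ *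
      iteratedFDeriv ℝ k (fun y => c + b * G (s • y)) x (fun _ => x' - x)
      = ((k.factorial : ℝ))⁻¹ * iteratedFDeriv ℝ k (fun _ => c) x (fun _ => x' - x)
        + b * (((k.factorial : ℝ))⁻¹ *
          iteratedFDeriv ℝ k G (s • x) (fun _ => s • x' - s • x)) := by
    intro k hk
    rw [key k (Nat.lt_succ_iff.1 (Finset.mem_range.1 hk)), hd]
    simp only [add_apply, smul_apply,
      smul_eq_mul]
    ring
  -- Of the Taylor terms of the constant `c` only the one of order zero survives.
  rw [Finset.sum_congr rfl hc, Finset.sum_add_distrib, ← Finset.mul_sum,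
    Finset.sum_range_succ' (fun k => ((k.factorial : ℝ))⁻¹ *
      iteratedFDeriv ℝ k (fun _ => c) x (fun _ => x' - x))]
  simp [iteratedFDeriv_const_of_ne]

/-- Shrinking a profile to width `r` multiplies its Hölder constant by `r^(-β)`, so an amplitude `b`
of order `r^β` is affordable. -/
lemma const_add_mul_comp_smul_mem_holderClass {G : Feat d → ℝ} {β L M c b r : ℝ} (hβ : 0 < β)
    (hr : 0 < r) (hG : ContDiff ℝ (strictFloor β + 1 : ℕ) G)
    (hM : ∀ k ≤ strictFloor β + 1, ∀ y, ‖iteratedFDeriv ℝ k G y‖ ≤ M)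
    (hb : |b| * ((strictFloor β + 2) * M) ≤ L * r ^ β) :
    (fun y => c + b * G (r⁻¹ • y)) ∈ HolderClass d β L := by
  have hG' : ContDiff ℝ (strictFloor β : ℕ) G := hG.of_le (by exact_mod_cast Nat.le_succ _)
  refine ⟨contDiff_const.add (contDiff_const.mul (hG'.comp (contDiff_const_smul _))), ?_⟩
  intro x x'
  rw [taylorPoly_const_add_mul_comp_smul hG']
  have h1 := abs_sub_taylorPoly_le_rpow hβ hG hM (r⁻¹ • x) (r⁻¹ • x')
  rw [← smul_sub, norm_smul, Real.norm_of_nonneg (inv_nonneg.2 hr.le),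
    Real.mul_rpow (inv_nonneg.2 hr.le) (norm_nonneg _), Real.inv_rpow hr.le] at h1
  have hrβ : 0 < r ^ β := Real.rpow_pos_of_pos hr β
  have e : c + b * G (r⁻¹ • x') - (c + b * taylorPoly (strictFloor β) G (r⁻¹ • x) (r⁻¹ • x'))
      = b * (G (r⁻¹ • x') - taylorPoly (strictFloor β) G (r⁻¹ • x) (r⁻¹ • x')) := by ring
  rw [e, abs_mul]
  calc _ ≤ |b| * ((strictFloor β + 2) * M * ((r ^ β)⁻¹ * ‖x - x'‖ ^ β)) := by gcongr
    _ = (|b| * ((strictFloor β + 2) * M)) * ((r ^ β)⁻¹ * ‖x - x'‖ ^ β) := by ring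
    _ ≤ (L * r ^ β) * ((r ^ β)⁻¹ * ‖x - x'‖ ^ β) := by gcongr
    _ = _ := by field_simp

end Taylor

/-! ### Sums of separated bumps -/

section Bumps

variable {d : ℕ}

lemma exists_bump (d : ℕ) : ∃ u : Feat d → ℝ, (∀ n : ℕ, ContDiff ℝ n u) ∧
    (∀ x, u x ∈ Set.Icc (0 : ℝ) 1) ∧ (∀ x, ‖x‖ ≤ 1 → u x = 1) ∧
    tsupport u = Metric.closedBall 0 2 := by
  let f : ContDiffBump (0 : Feat d) := ⟨1, 2, one_pos, one_lt_two⟩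
  refine ⟨f, fun n => f.contDiff, fun x => ⟨f.nonneg, f.le_one⟩, fun x hx => ?_, f.tsupport_eq⟩
  exact f.one_of_mem_closedBall (by simpa using hx)

lemma exists_iteratedFDeriv_bound {u : Feat d → ℝ} (hu : ∀ n : ℕ, ContDiff ℝ n u)
    (hc : HasCompactSupport u) (N : ℕ) :
    ∃ M : ℝ, 0 < M ∧ ∀ k ≤ N, ∀ y, ‖iteratedFDeriv ℝ k u y‖ ≤ M := by
  have h : ∀ k : ℕ, ∃ M, ∀ y, ‖iteratedFDeriv ℝ k u y‖ ≤ M := fun k =>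
    (hc.iteratedFDeriv k).exists_bound_of_continuous
      ((hu k).continuous_iteratedFDeriv le_rfl)
  choose M hM using h
  refine ⟨1 + ∑ k ∈ Finset.range (N + 1), |M k|, by positivity, fun k hk y => ?_⟩
  have h1 : |M k| ≤ ∑ k ∈ Finset.range (N + 1), |M k| :=
    Finset.single_le_sum (f := fun k => |M k|) (fun _ _ => abs_nonneg _)
      (Finset.mem_range.2 (Nat.lt_succ_iff.2 hk))
  linarith [hM k y, le_abs_self (M k)]

/-- The sum of the translates of `u` to the points `c j`, with weights `σ j`. -/
def bumpSum {ι : Type*} [Fintype ι] (u : Feat d → ℝ) (c : ι → Feat d) (σ : ι → ℝ)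
    (y : Feat d) : ℝ :=
  ∑ j, σ j * u (y - c j)

lemma norm_sum_le_of_subsingleton_support {ι F : Type*} [Fintype ι] [SeminormedAddCommGroup F]
    {f : ι → F} {M : ℝ} (hM0 : 0 ≤ M) (hM : ∀ j, ‖f j‖ ≤ M)
    (hf : ∀ i j, f i ≠ 0 → f j ≠ 0 → i = j) : ‖∑ j, f j‖ ≤ M := by
  by_cases h : ∃ i, f i ≠ 0
  · obtain ⟨i, hi⟩ := h
    rw [Fintype.sum_eq_single i fun j hj => by_contra fun h => hj (hf j i h hi)]
    exact hM i
  · push Not at h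
    simpa [h] using hM0

section

variable {ι : Type*} [Fintype ι] {u : Feat d → ℝ} {c : ι → Feat d} {σ : ι → ℝ}

lemma bumpSum_contDiff (n : ℕ) (hu : ContDiff ℝ n u) : ContDiff ℝ n (bumpSum u c σ) :=
  ContDiff.sum fun _ _ => contDiff_const.mul (hu.comp (contDiff_id.sub contDiff_const))

/-- The bumps live in balls of radius `2` about centres more than `4` apart, so at each point at
most one contributes. The bound is therefore that of a single bump, independent of their number. -/
lemma norm_iteratedFDeriv_bumpSum_le {k : ℕ} (hu : ContDiff ℝ k u)
    (hsupp : tsupport u ⊆ Metric.closedBall 0 2) (hc : ∀ i j, i ≠ j → 4 < dist (c i) (c j))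
    (hσ : ∀ j, |σ j| ≤ 1) {M : ℝ} (hM : ∀ y, ‖iteratedFDeriv ℝ k u y‖ ≤ M) (y : Feat d) :
    ‖iteratedFDeriv ℝ k (bumpSum u c σ) y‖ ≤ M := by
  have hM0 : 0 ≤ M := (norm_nonneg _).trans (hM 0)
  have hu' : ∀ j, ContDiff ℝ k (fun y => u (y - c j)) := fun j =>
    hu.comp (contDiff_id.sub contDiff_const)
  have h1 : iteratedFDeriv ℝ k (bumpSum u c σ) y
      = ∑ j, σ j • iteratedFDeriv ℝ k u (y - c j) := by
    unfold bumpSum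
    rw [iteratedFDeriv_fun_sum_apply fun j _ => (contDiff_const.mul (hu' j)).contDiffAt]
    refine Finset.sum_congr rfl fun j _ => ?_
    have h2 := iteratedFDeriv_const_smul_apply (a := σ j) (hu' j).contDiffAt (x := y)
    rw [iteratedFDeriv_comp_sub] at h2
    exact h2
  rw [h1]
  refine norm_sum_le_of_subsingleton_support hM0 (fun j => ?_) fun i j hi hj => ?_
  · rw [norm_smul, Real.norm_eq_abs]
    calc _ ≤ 1 * M := mul_le_mul (hσ j) (hM _) (norm_nonneg _) zero_le_one
      _ = M := one_mul M
  · by_contra hij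
    have hb : ∀ i, σ i • iteratedFDeriv ℝ k u (y - c i) ≠ 0 → dist y (c i) ≤ 2 := by
      intro i hi
      have := hsupp (support_iteratedFDeriv_subset k (right_ne_zero_of_smul hi))
      simpa [dist_eq_norm] using this
    have := hc i j hij
    linarith [dist_triangle_left (c i) (c j) y, hb i hi, hb j hj]

lemma abs_bumpSum_le_one (hu : ∀ x, u x ∈ Set.Icc (0 : ℝ) 1) (hu' : ContDiff ℝ (0 : ℕ) u)
    (hsupp : tsupport u ⊆ Metric.closedBall 0 2) (hc : ∀ i j, i ≠ j → 4 < dist (c i) (c j))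
    (hσ : ∀ j, |σ j| ≤ 1) (y : Feat d) : |bumpSum u c σ y| ≤ 1 := by
  have h := norm_iteratedFDeriv_bumpSum_le hu' hsupp hc hσ (M := 1)
    (fun y => by
      rw [norm_iteratedFDeriv_zero, Real.norm_eq_abs, abs_of_nonneg (hu y).1]
      exact (hu y).2) y
  rwa [norm_iteratedFDeriv_zero] at h

lemma bumpSum_of_dist_le_one (hone : ∀ x, ‖x‖ ≤ 1 → u x = 1)
    (hsupp : tsupport u ⊆ Metric.closedBall 0 2) (hc : ∀ i j, i ≠ j → 4 < dist (c i) (c j))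
    {y : Feat d} {j : ι} (hy : dist y (c j) ≤ 1) : bumpSum u c σ y = σ j := by
  rw [bumpSum, Fintype.sum_eq_single j fun i hij => ?_, hone _ (by rwa [← dist_eq_norm]), mul_one]
  suffices h0 : y - c i ∉ tsupport u by rw [image_eq_zero_of_notMem_tsupport h0, mul_zero]
  intro h
  have := hsupp h
  rw [mem_closedBall_zero_iff, ← dist_eq_norm] at this
  linarith [dist_triangle_left (c i) (c j) y, hc i j hij]

lemma bumpSum_of_forall_two_lt_dist (hsupp : tsupport u ⊆ Metric.closedBall 0 2)
    {y : Feat d} (hy : ∀ j, 2 < dist y (c j)) : bumpSum u c σ y = 0 := by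
  refine Finset.sum_eq_zero fun j _ => ?_
  suffices h0 : y - c j ∉ tsupport u by rw [image_eq_zero_of_notMem_tsupport h0, mul_zero]
  intro h
  have := hsupp h
  rw [mem_closedBall_zero_iff, ← dist_eq_norm] at this
  linarith [hy j]

end

end Bumps

end PlugIn

namespace PlugIn

/-! ### Change of measure for samples -/

section TwoPoint

variable {Ω : Type*} [MeasurableSpace Ω]

lemma lintegral_pi_prod {n : ℕ} (μ : Measure Ω) [IsProbabilityMeasure μ]
    {f : Fin n → Ω → ℝ≥0∞} (hf : ∀ i, Measurable (f i)) :
    ∫⁻ z, ∏ i, f i (z i) ∂(Measure.pi fun _ : Fin n => μ) = ∏ i, ∫⁻ x, f i x ∂μ := by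
  have hind : iIndepFun (fun i (z : Fin n → Ω) => f i (z i)) (Measure.pi fun _ : Fin n => μ) :=
    iIndepFun_pi fun i => (hf i).aemeasurable
  rw [lintegral_prod_eq_prod_lintegral_of_indepFun Finset.univ _ hind
    fun i => (hf i).comp (measurable_pi_apply i)]
  refine Finset.prod_congr rfl fun i _ => ?_
  exact (measurePreserving_eval (fun _ : Fin n => μ) i).lintegral_comp (hf i)

lemma pi_withDensity {n : ℕ} (μ : Measure Ω) [IsProbabilityMeasure μ] {f : Ω → ℝ≥0∞}
    (hf : Measurable f) [SigmaFinite (μ.withDensity f)] :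
    Measure.pi (fun _ : Fin n => μ.withDensity f)
      = (Measure.pi fun _ : Fin n => μ).withDensity fun z => ∏ i, f (z i) := by
  refine Measure.pi_eq fun s hs => ?_
  rw [withDensity_apply _ (MeasurableSet.univ_pi hs),
    ← lintegral_indicator (MeasurableSet.univ_pi hs)]
  have h1 : (Set.univ.pi s).indicator (fun z : Fin n → Ω => ∏ i, f (z i))
      = fun z => ∏ i, (s i).indicator f (z i) := by
    ext z
    by_cases hz : z ∈ Set.univ.pi s
    · rw [Set.indicator_of_mem hz]
      exact Finset.prod_congr rfl fun i _ => (Set.indicator_of_mem (hz i trivial) f).symm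
    · rw [Set.indicator_of_notMem hz]
      simp only [Set.mem_pi, Set.mem_univ, forall_const, not_forall] at hz
      obtain ⟨i, hi⟩ := hz
      exact (Finset.prod_eq_zero (Finset.mem_univ i) (Set.indicator_of_notMem hi f)).symm
  rw [h1, lintegral_pi_prod μ fun i => hf.indicator (hs i)]
  refine Finset.prod_congr rfl fun i _ => ?_
  rw [withDensity_apply _ (hs i), lintegral_indicator (hs i)]

lemma integral_pi_withDensity_ofReal {n : ℕ} (μ : Measure Ω) [IsProbabilityMeasure μ]
    {g : Ω → ℝ} (hg : Measurable g) (hg0 : ∀ x, 0 ≤ g x) (N : (Fin n → Ω) → ℝ) :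
    ∫ z, N z ∂(Measure.pi fun _ : Fin n => μ.withDensity fun x => ENNReal.ofReal (g x))
      = ∫ z, (∏ i, g (z i)) * N z ∂(Measure.pi fun _ : Fin n => μ) := by
  have hm : Measurable fun z : Fin n → Ω => ∏ i, ENNReal.ofReal (g (z i)) :=
    Finset.measurable_prod _ fun i _ => (hg.comp (measurable_pi_apply i)).ennreal_ofReal
  rw [pi_withDensity μ hg.ennreal_ofReal, integral_withDensity_eq_integral_toReal_smul hm
    (.of_forall fun z => ENNReal.prod_lt_top fun i _ => ENNReal.ofReal_lt_top)]
  refine integral_congr_ae (.of_forall fun z => ?_)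
  simp [ENNReal.toReal_prod, hg0]

lemma integrable_of_abs_le {μ : Measure Ω} [IsFiniteMeasure μ] {f : Ω → ℝ} (hf : Measurable f)
    {C : ℝ} (hC : ∀ x, |f x| ≤ C) : Integrable f μ :=
  Integrable.of_bound hf.aestronglyMeasurable C (.of_forall hC)

/-- Second-moment comparison of two product laws with densities `1 ± h` relative to their midpoint.
With likelihoods `A` and `B`, the difference is at most `1/4 + ∫ (A - B)²`. The second moments
factorise over the sample: with `V = ∫ h²` and `∫ h = 0`, one observation gives `∫ (1 ± h)² = 1 + V`
and `∫ (1 + h)(1 - h) = 1 - V`. -/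
lemma integral_sub_integral_perturbed_le {n : ℕ} (μ : Measure Ω) [IsProbabilityMeasure μ]
    {h : Ω → ℝ} (hm : Measurable h) (hb : ∀ x, |h x| ≤ 1) (h0 : ∫ x, h x ∂μ = 0)
    {N : (Fin n → Ω) → ℝ} (hN : Measurable N) (hN01 : ∀ z, N z ∈ Set.Icc (0 : ℝ) 1) :
    (∫ z, N z ∂(Measure.pi fun _ : Fin n => μ.withDensity fun x => ENNReal.ofReal (1 + h x)))
      - ∫ z, N z ∂(Measure.pi fun _ : Fin n => μ.withDensity fun x => ENNReal.ofReal (1 - h x))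
      ≤ 1 / 4 + 2 * ((1 + ∫ x, h x ^ 2 ∂μ) ^ n - (1 - ∫ x, h x ^ 2 ∂μ) ^ n) := by
  set ν := Measure.pi fun _ : Fin n => μ
  have hpm : ∀ x, 0 ≤ 1 + h x ∧ 1 + h x ≤ 2 ∧ 0 ≤ 1 - h x ∧ 1 - h x ≤ 2 := fun x => by
    have := abs_le.1 (hb x)
    refine ⟨?_, ?_, ?_, ?_⟩ <;> linarith
  have hp : Measurable fun x => 1 + h x := measurable_const.add hm
  have hq : Measurable fun x => 1 - h x := measurable_const.sub hm
  rw [integral_pi_withDensity_ofReal μ hp (fun x => (hpm x).1),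
    integral_pi_withDensity_ofReal μ hq (fun x => (hpm x).2.2.1)]
  set A : (Fin n → Ω) → ℝ := fun z => ∏ i, (1 + h (z i)) with hA
  set B : (Fin n → Ω) → ℝ := fun z => ∏ i, (1 - h (z i)) with hB
  have hAm : Measurable A := Finset.measurable_prod _ fun i _ => hp.comp (measurable_pi_apply i)
  have hBm : Measurable B := Finset.measurable_prod _ fun i _ => hq.comp (measurable_pi_apply i)
  have hA2 : ∀ z, |A z| ≤ 2 ^ n := fun z => by
    rw [hA, Finset.abs_prod]
    calc _ ≤ ∏ _i : Fin n, (2 : ℝ) := Finset.prod_le_prod (fun i _ => abs_nonneg _)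
          fun i _ => by rw [abs_of_nonneg (hpm _).1]; exact (hpm _).2.1
      _ = 2 ^ n := by simp
  have hB2 : ∀ z, |B z| ≤ 2 ^ n := fun z => by
    rw [hB, Finset.abs_prod]
    calc _ ≤ ∏ _i : Fin n, (2 : ℝ) := Finset.prod_le_prod (fun i _ => abs_nonneg _)
          fun i _ => by rw [abs_of_nonneg (hpm _).2.2.1]; exact (hpm _).2.2.2
      _ = 2 ^ n := by simp
  have hNabs : ∀ z, |N z| ≤ 1 := fun z => by
    rw [abs_of_nonneg (hN01 z).1]; exact (hN01 z).2
  have hbd : ∀ {f g : (Fin n → Ω) → ℝ} {C D : ℝ}, (∀ z, |f z| ≤ C) → (∀ z, |g z| ≤ D) →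
      ∀ z, |f z * g z| ≤ C * D := fun {f g C D} hf hg z => by
    rw [abs_mul]
    exact mul_le_mul (hf z) (hg z) (abs_nonneg _) ((abs_nonneg _).trans (hf z))
  have iAN : Integrable (fun z => A z * N z) ν := integrable_of_abs_le (hAm.mul hN) (hbd hA2 hNabs)
  have iBN : Integrable (fun z => B z * N z) ν := integrable_of_abs_le (hBm.mul hN) (hbd hB2 hNabs)
  have iAA : Integrable (fun z => A z * A z) ν := integrable_of_abs_le (hAm.mul hAm) (hbd hA2 hA2)
  have iBB : Integrable (fun z => B z * B z) ν := integrable_of_abs_le (hBm.mul hBm) (hbd hB2 hB2)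
  have iAB : Integrable (fun z => A z * B z) ν := integrable_of_abs_le (hAm.mul hBm) (hbd hA2 hB2)
  have ih : Integrable h μ := integrable_of_abs_le hm hb
  have ihh : Integrable (fun x => h x ^ 2) μ := integrable_of_abs_le (hm.pow_const 2) (C := 1)
    fun x => by rw [abs_pow]; exact pow_le_one₀ (abs_nonneg _) (hb x)
  have ih2 : Integrable (fun x => 2 * h x) μ := ih.const_mul 2
  have ihp : Integrable (fun x => 1 + 2 * h x) μ := (integrable_const _).add ih2
  have ihn : Integrable (fun x => 1 - 2 * h x) μ := (integrable_const _).sub ih2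
  have iAABB : Integrable (fun z => A z * A z + B z * B z) ν := iAA.add iBB
  have iD : Integrable (fun z => A z * A z + B z * B z - 2 * (A z * B z)) ν :=
    iAABB.sub (iAB.const_mul 2)
  have eAA : ∫ z, A z * A z ∂ν = (1 + ∫ x, h x ^ 2 ∂μ) ^ n := by
    simp only [hA, ← Finset.prod_mul_distrib]
    rw [integral_fintype_prod_eq_pow (fun x => (1 + h x) * (1 + h x)), Fintype.card_fin]
    have : ∀ x, (1 + h x) * (1 + h x) = 1 + 2 * h x + h x ^ 2 := fun x => by ring
    simp_rw [this]
    rw [integral_add ihp ihh,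
      integral_add (integrable_const _) ih2, integral_const_mul, h0]
    simp
  have eBB : ∫ z, B z * B z ∂ν = (1 + ∫ x, h x ^ 2 ∂μ) ^ n := by
    simp only [hB, ← Finset.prod_mul_distrib]
    rw [integral_fintype_prod_eq_pow (fun x => (1 - h x) * (1 - h x)), Fintype.card_fin]
    have : ∀ x, (1 - h x) * (1 - h x) = 1 - 2 * h x + h x ^ 2 := fun x => by ring
    simp_rw [this]
    rw [integral_add ihn ihh,
      integral_sub (integrable_const _) ih2, integral_const_mul, h0]
    simp
  have eAB : ∫ z, A z * B z ∂ν = (1 - ∫ x, h x ^ 2 ∂μ) ^ n := by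
    simp only [hA, hB, ← Finset.prod_mul_distrib]
    rw [integral_fintype_prod_eq_pow (fun x => (1 + h x) * (1 - h x)), Fintype.card_fin]
    have : ∀ x, (1 + h x) * (1 - h x) = 1 - h x ^ 2 := fun x => by ring
    simp_rw [this]
    rw [integral_sub (integrable_const _) ihh]
    simp
  rw [← integral_sub iAN iBN]
  have hle : ∫ z, (A z * N z - B z * N z) ∂ν
      ≤ ∫ z, (1 / 4 + (A z * A z + B z * B z - 2 * (A z * B z))) ∂ν := by
    refine integral_mono (iAN.sub iBN)
      ((integrable_const _).add iD) fun z => ?_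
    have h1 := hN01 z
    have h2 : (A z - B z) * N z ≤ |A z - B z| := by
      calc _ ≤ |A z - B z| * N z := mul_le_mul_of_nonneg_right (le_abs_self _) h1.1
        _ ≤ |A z - B z| * 1 := mul_le_mul_of_nonneg_left h1.2 (abs_nonneg _)
        _ = _ := mul_one _
    -- The inequality used is `t ≤ 1/4 + t²` for `t = |A z - B z|`, that is `(t - 1/2)² ≥ 0`.
    have h3 := sq_abs (A z - B z)
    show A z * N z - B z * N z ≤ 1 / 4 + (A z * A z + B z * B z - 2 * (A z * B z))
    nlinarith [sq_nonneg (|A z - B z| - 1 / 2)]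
  refine hle.trans_eq ?_
  rw [integral_add (integrable_const _) iD,
    integral_sub iAABB (iAB.const_mul 2), integral_add iAA iBB, integral_const_mul,
    eAA, eBB, eAB]
  simp
  ring

/-- The powers are at most `1 + 2nV` and at least `1 - nV`, so they differ by at most `3nV ≤ 1/8`;
this fixes the constant `24`. -/
lemma one_add_pow_sub_one_sub_pow_le {n : ℕ} {V : ℝ} (hV : 0 ≤ V) (hn : n * V ≤ 1 / 24) :
    1 / 4 + 2 * ((1 + V) ^ n - (1 - V) ^ n) ≤ 1 / 2 := by
  rcases Nat.eq_zero_or_pos n with rfl | hpos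
  · norm_num
  have hn1 : (1 : ℝ) ≤ n := by exact_mod_cast hpos
  have hnV : 0 ≤ n * V := by positivity
  have hV1 : V ≤ 1 / 24 := by nlinarith
  have h1 : (1 + V) ^ n ≤ Real.exp (n * V) := by
    rw [Real.exp_nat_mul]
    gcongr
    linarith [Real.add_one_le_exp V]
  have h2 : 1 - n * V ≤ (1 - V) ^ n := by
    have := one_add_mul_le_pow (a := -V) (by linarith) n
    calc _ = 1 + n * -V := by ring
      _ ≤ _ := by simpa [sub_eq_add_neg] using this
  have h3 : Real.exp (n * V) ≤ 1 + 2 * (n * V) := by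
    have := Real.abs_exp_sub_one_le (x := n * V) (by rw [abs_of_nonneg hnV]; linarith)
    rw [abs_of_nonneg hnV] at this
    linarith [le_abs_self (Real.exp (n * V) - 1)]
  linarith

end TwoPoint

end PlugIn

namespace PlugIn

/-! ### Distributions with a given marginal and regression function -/

noncomputable section

/-- The sign `±1` attached to a label. -/
def labelSign (y : Fin 2) : ℝ := if y = 1 then 1 else -1

@[simp] lemma labelSign_one : labelSign 1 = 1 := by simp [labelSign]

@[simp] lemma labelSign_zero : labelSign 0 = -1 := by simp [labelSign]

lemma labelSign_mul_self (y : Fin 2) : labelSign y * labelSign y = 1 := by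
  unfold labelSign; split_ifs <;> norm_num

lemma abs_labelSign (y : Fin 2) : |labelSign y| = 1 := by
  unfold labelSign; split_ifs <;> norm_num

lemma measurable_labelSign : Measurable labelSign := measurable_of_countable _

/-- The fair distribution on labels. -/
def fairLabel : Measure (Fin 2) := (2⁻¹ : ℝ≥0∞) • Measure.count

instance : IsProbabilityMeasure fairLabel := by
  refine ⟨?_⟩
  simp [fairLabel, Measure.count_univ, ENNReal.inv_mul_cancel]

lemma integral_fairLabel (F : Fin 2 → ℝ) : ∫ y, F y ∂fairLabel = (F 0 + F 1) / 2 := by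
  rw [fairLabel, integral_smul_measure, integral_countable (by simp)]
  simp
  ring

variable {d : ℕ}

/-- The distribution on `𝒵` with marginal `Q` and regression function `(1 + φ) / 2`. -/
def labelled (Q : Measure (Feat d)) (φ : Feat d → ℝ) : Measure (Obs d) :=
  (Q.prod fairLabel).withDensity fun z => ENNReal.ofReal (1 + labelSign z.2 * φ z.1)

section

variable {Q : Measure (Feat d)} [IsProbabilityMeasure Q] {φ : Feat d → ℝ}

lemma abs_labelSign_mul (y : Fin 2) (a : ℝ) : |labelSign y * a| = |a| := by
  rw [abs_mul, abs_labelSign, one_mul]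

lemma measurable_labelSign_mul (hφ : Measurable φ) :
    Measurable fun z : Obs d => labelSign z.2 * φ z.1 :=
  (measurable_labelSign.comp measurable_snd).mul (hφ.comp measurable_fst)

lemma one_add_labelSign_mul_nonneg (hφ1 : ∀ x, |φ x| ≤ 1) (z : Obs d) :
    0 ≤ 1 + labelSign z.2 * φ z.1 := by
  have := (abs_le.1 ((abs_labelSign_mul z.2 (φ z.1)).le.trans (hφ1 z.1))).1
  linarith

lemma integral_labelled (hφ : Measurable φ) (hφ1 : ∀ x, |φ x| ≤ 1) {F : Obs d → ℝ}
    (hF : Measurable F) {C : ℝ} (hC : ∀ z, |F z| ≤ C) :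
    ∫ z, F z ∂labelled Q φ
      = ∫ x, ((1 - φ x) * F (x, 0) + (1 + φ x) * F (x, 1)) / 2 ∂Q := by
  have hm := measurable_labelSign_mul hφ
  have hm' : Measurable fun z : Obs d => 1 + labelSign z.2 * φ z.1 := measurable_const.add hm
  rw [labelled, integral_withDensity_eq_integral_toReal_smul hm'.ennreal_ofReal
    (.of_forall fun z => ENNReal.ofReal_lt_top)]
  have h1 : ∀ z : Obs d, (ENNReal.ofReal (1 + labelSign z.2 * φ z.1)).toReal • F z
      = (1 + labelSign z.2 * φ z.1) * F z := fun z => by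
    rw [ENNReal.toReal_ofReal (one_add_labelSign_mul_nonneg hφ1 z), smul_eq_mul]
  simp_rw [h1]
  have hi : Integrable (fun z : Obs d => (1 + labelSign z.2 * φ z.1) * F z)
      (Q.prod fairLabel) := by
    refine integrable_of_abs_le (hm'.mul hF) (C := 2 * C) fun z => ?_
    rw [abs_mul]
    refine mul_le_mul ?_ (hC z) (abs_nonneg _) zero_le_two
    have h2 := (abs_labelSign_mul z.2 (φ z.1)).le.trans (hφ1 z.1)
    calc _ ≤ |(1 : ℝ)| + |labelSign z.2 * φ z.1| := abs_add_le _ _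
      _ ≤ 2 := by rw [abs_one]; linarith
  rw [integral_prod _ hi]
  simp_rw [integral_fairLabel]
  simp [sub_eq_add_neg]

lemma isFiniteMeasure_labelled (hφ : Measurable φ) (hφ1 : ∀ x, |φ x| ≤ 1) :
    IsFiniteMeasure (labelled Q φ) := by
  refine isFiniteMeasure_withDensity_ofReal (Integrable.hasFiniteIntegral ?_)
  refine integrable_of_abs_le (measurable_const.add (measurable_labelSign_mul hφ)) (C := 2)
    fun z => ?_
  have h2 := (abs_labelSign_mul z.2 (φ z.1)).le.trans (hφ1 z.1)
  calc _ ≤ |(1 : ℝ)| + |labelSign z.2 * φ z.1| := abs_add_le _ _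
    _ ≤ 2 := by rw [abs_one]; linarith

lemma labelled_real (hφ : Measurable φ) (hφ1 : ∀ x, |φ x| ≤ 1) {S : Set (Obs d)}
    (hS : MeasurableSet S) :
    (labelled Q φ).real S = ∫ x, ((1 - φ x) * S.indicator 1 (x, 0)
      + (1 + φ x) * S.indicator 1 (x, 1)) / 2 ∂Q := by
  rw [← integral_indicator_one hS]
  refine integral_labelled hφ hφ1 (measurable_one.indicator hS) (C := 1) fun z => ?_
  by_cases hz : z ∈ S <;> simp [hz]

lemma isProbabilityMeasure_labelled (hφ : Measurable φ) (hφ1 : ∀ x, |φ x| ≤ 1) :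
    IsProbabilityMeasure (labelled Q φ) := by
  have := isFiniteMeasure_labelled (Q := Q) hφ hφ1
  have h := labelled_real (Q := Q) hφ hφ1 MeasurableSet.univ
  have h1 : ∀ x, ((1 - φ x) * (Set.univ : Set (Obs d)).indicator (1 : Obs d → ℝ) (x, 0)
      + (1 + φ x) * (Set.univ : Set (Obs d)).indicator (1 : Obs d → ℝ) (x, 1)) / 2 = 1 := by
    intro x; simp
  simp_rw [h1] at h
  refine ⟨?_⟩
  rw [← ENNReal.toReal_eq_one_iff]
  simpa [Measure.real] using h

lemma fst_labelled (hφ : Measurable φ) (hφ1 : ∀ x, |φ x| ≤ 1) : (labelled Q φ).fst = Q := by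
  have := isProbabilityMeasure_labelled (Q := Q) hφ hφ1
  refine Measure.ext fun S hS => ?_
  rw [← measureReal_eq_measureReal_iff, Measure.real, Measure.fst_apply hS]
  change (labelled Q φ).real _ = _
  rw [labelled_real hφ hφ1 (measurable_fst hS), ← integral_indicator_one hS]
  refine integral_congr_ae (.of_forall fun x => ?_)
  by_cases hx : x ∈ S
  · simp [hx]
  · simp [hx]

omit [IsProbabilityMeasure Q] in
-- For a sign `s`, `(1 + s φ)(1 + s ψ) = 1 + s (φ + ψ) + φ ψ`, and the last term vanishes for
-- disjoint supports. Changing the regression function on one cell thus becomes a multiplicative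
-- perturbation of the joint law.
lemma labelled_withDensity {ψ : Feat d → ℝ} (hφ : Measurable φ) (hφ1 : ∀ x, |φ x| ≤ 1)
    (hψ : Measurable ψ) (hφψ : ∀ x, φ x * ψ x = 0) :
    (labelled Q φ).withDensity (fun z => ENNReal.ofReal (1 + labelSign z.2 * ψ z.1))
      = labelled Q (φ + ψ) := by
  have h1 : Measurable fun z : Obs d => ENNReal.ofReal (1 + labelSign z.2 * φ z.1) :=
    (measurable_const.add (measurable_labelSign_mul hφ)).ennreal_ofReal
  have h2 : Measurable fun z : Obs d => ENNReal.ofReal (1 + labelSign z.2 * ψ z.1) :=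
    (measurable_const.add (measurable_labelSign_mul hψ)).ennreal_ofReal
  rw [labelled, ← withDensity_mul _ h1 h2, labelled]
  congr 1
  ext z
  rw [Pi.mul_apply, ← ENNReal.ofReal_mul (one_add_labelSign_mul_nonneg hφ1 z)]
  congr 1
  have h3 := labelSign_mul_self z.2
  have h4 := hφψ z.1
  rw [Pi.add_apply]
  linear_combination (φ z.1 * ψ z.1) * h3 + h4

/-- The probability measure `labelled Q φ`. -/
def labelledProb (Q : Measure (Feat d)) [IsProbabilityMeasure Q] (φ : Feat d → ℝ)
    (hφ : Measurable φ) (hφ1 : ∀ x, |φ x| ≤ 1) : ProbabilityMeasure (Obs d) :=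
  ⟨labelled Q φ, isProbabilityMeasure_labelled hφ hφ1⟩

lemma marginalX_labelledProb (hφ : Measurable φ) (hφ1 : ∀ x, |φ x| ≤ 1) :
    marginalX (labelledProb Q φ hφ hφ1) = Q :=
  fst_labelled hφ hφ1

lemma measurable_regression (P : ProbabilityMeasure (Obs d)) : Measurable (regression P) :=
  ((P : Measure (Obs d)).condKernel.measurable_coe (measurableSet_singleton 1)).ennreal_toReal

lemma regression_mem_Icc (P : ProbabilityMeasure (Obs d)) (x : Feat d) :
    regression P x ∈ Set.Icc (0 : ℝ) 1 :=
  ⟨measureReal_nonneg, measureReal_le_one⟩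

/-- Both sides have the same integral over every measurable `S`, namely the mass of `S ×ˢ {1}`. -/
lemma regression_labelledProb (hφ : Measurable φ) (hφ1 : ∀ x, |φ x| ≤ 1) :
    regression (labelledProb Q φ hφ hφ1) =ᵐ[Q] fun x => (1 + φ x) / 2 := by
  set P := labelledProb Q φ hφ hφ1 with hP
  have hfst : (P : Measure (Obs d)).fst = Q := fst_labelled hφ hφ1
  have hreg : Integrable (regression P) Q := integrable_of_abs_le (measurable_regression P)
    (C := 1) fun x => by
      rw [abs_of_nonneg (regression_mem_Icc P x).1]; exact (regression_mem_Icc P x).2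
  have hφm : Measurable fun x => (1 + φ x) / 2 := (measurable_const.add hφ).div_const 2
  have hφi : Integrable (fun x => (1 + φ x) / 2) Q := integrable_of_abs_le hφm
    (C := 1) fun x => by
      have := abs_le.1 (hφ1 x)
      rw [abs_le]; constructor <;> linarith
  refine Integrable.ae_eq_of_forall_setIntegral_eq _ _ hreg hφi fun S hS _ => ?_
  have h1 : ∫ x in S, regression P x ∂Q = (P : Measure (Obs d)).real (S ×ˢ {1}) := by
    have h2 := Measure.setLIntegral_condKernel_eq_measure_prod (ρ := (P : Measure (Obs d))) hS
      (measurableSet_singleton (1 : Fin 2))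
    rw [hfst] at h2
    rw [Measure.real, ← h2]
    exact integral_toReal
      (((P : Measure (Obs d)).condKernel.measurable_coe (measurableSet_singleton 1)).aemeasurable)
      (.of_forall fun x => measure_lt_top _ _)
  have h3 : (P : Measure (Obs d)).real (S ×ˢ {1}) = (labelled Q φ).real (S ×ˢ {1}) := rfl
  rw [h1, h3, labelled_real hφ hφ1 (hS.prod (measurableSet_singleton 1)), ← integral_indicator hS]
  refine integral_congr_ae (.of_forall fun x => ?_)
  by_cases hx : x ∈ S <;> simp [hx, Set.indicator]

lemma risk_labelledProb (hφ : Measurable φ) (hφ1 : ∀ x, |φ x| ≤ 1) {f : Feat d → Fin 2}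
    (hf : Measurable f) :
    risk (labelledProb Q φ hφ hφ1) f = ∫ x, (1 - labelSign (f x) * φ x) / 2 ∂Q := by
  have hS : MeasurableSet {z : Obs d | z.2 ≠ f z.1} :=
    (measurableSet_eq_fun measurable_snd (hf.comp measurable_fst)).compl
  change (labelled Q φ).real _ = _
  rw [labelled_real hφ hφ1 hS]
  refine integral_congr_ae (.of_forall fun x => ?_)
  have h : f x = 0 ∨ f x = 1 := by omega
  rcases h with h | h <;> simp [h, Set.indicator]

lemma measurable_bayesRule (P : ProbabilityMeasure (Obs d)) : Measurable (bayesRule P) := by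
  classical
  have : bayesRule P = fun x => if 1 / 2 ≤ regression P x then 1 else 0 := by
    ext x; simp [bayesRule]
  rw [this]
  exact Measurable.ite (measurableSet_le measurable_const (measurable_regression P))
    measurable_const measurable_const

lemma risk_bayesRule_labelledProb (hφ : Measurable φ) (hφ1 : ∀ x, |φ x| ≤ 1) :
    risk (labelledProb Q φ hφ hφ1) (bayesRule (labelledProb Q φ hφ hφ1))
      = ∫ x, (1 - |φ x|) / 2 ∂Q := by
  rw [risk_labelledProb hφ hφ1 (measurable_bayesRule _)]
  refine integral_congr_ae ?_
  filter_upwards [regression_labelledProb (Q := Q) hφ hφ1] with x hx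
  rw [bayesRule, hx]
  split_ifs with h
  · rw [labelSign_one, abs_of_nonneg (by linarith), one_mul]
  · rw [labelSign_zero, abs_of_neg (by linarith), neg_one_mul]

/-- Moving the Bayes risk inside both integrals leaves an integrand that vanishes wherever `φ` does,
so only the cells will contribute. -/
lemma excessRisk_labelledProb {n : ℕ} (hφ : Measurable φ) (hφ1 : ∀ x, |φ x| ≤ 1)
    {f : (Fin n → Obs d) → Feat d → Fin 2} (hf : IsClassifier f) :
    excessRisk (labelledProb Q φ hφ hφ1) f
      = ∫ z, ∫ x, (|φ x| - labelSign (f z x) * φ x) / 2 ∂Q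
          ∂(Measure.pi fun _ : Fin n => labelled Q φ) := by
  have := isProbabilityMeasure_labelled (Q := Q) hφ hφ1
  have hfz : ∀ z, Measurable (f z) := fun z => hf.comp measurable_prodMk_left
  have hi1 : Integrable (fun x => (1 - |φ x|) / 2) Q := by
    refine integrable_of_abs_le ((measurable_const.sub hφ.abs).div_const 2) (C := 1) fun x => ?_
    have := hφ1 x
    have := abs_nonneg (φ x)
    rw [abs_le]; constructor <;> linarith
  have hms : Measurable fun p : (Fin n → Obs d) × Feat d =>
      (1 - labelSign (f p.1 p.2) * φ p.2) / 2 :=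
    (measurable_const.sub ((measurable_labelSign.comp hf).mul (hφ.comp measurable_snd))).div_const 2
  have hbd : ∀ y x, |(1 - labelSign y * φ x) / 2| ≤ 1 := fun y x => by
    have := abs_le.1 ((abs_labelSign_mul y (φ x)).le.trans (hφ1 x))
    rw [abs_le]; constructor <;> linarith
  have hi2 : ∀ z, Integrable (fun x => (1 - labelSign (f z x) * φ x) / 2) Q := fun z =>
    integrable_of_abs_le (hms.comp measurable_prodMk_left) (C := 1) fun x => hbd _ _
  have hi3 : Integrable (fun z => ∫ x, (1 - labelSign (f z x) * φ x) / 2 ∂Q)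
      (Measure.pi fun _ : Fin n => labelled Q φ) := by
    refine Integrable.of_bound
      (hms.stronglyMeasurable.integral_prod_right'.aestronglyMeasurable) 1 (.of_forall fun z => ?_)
    refine (norm_integral_le_of_norm_le_const (.of_forall fun x => hbd _ _)).trans ?_
    simp
  have hr : ∀ z, risk (labelledProb Q φ hφ hφ1) (f z)
      = ∫ x, (1 - labelSign (f z x) * φ x) / 2 ∂Q := fun z => risk_labelledProb hφ hφ1 (hfz z)
  rw [excessRisk, risk_bayesRule_labelledProb]
  simp_rw [hr]
  change ∫ z, _ ∂(Measure.pi fun _ : Fin n => labelled Q φ) - _ = _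
  have hc : ∫ x, (1 - |φ x|) / 2 ∂Q
      = ∫ z, (∫ x, (1 - |φ x|) / 2 ∂Q) ∂(Measure.pi fun _ : Fin n => labelled Q φ) := by simp
  rw [hc, ← integral_sub hi3 (integrable_const _)]
  refine integral_congr_ae (.of_forall fun z => ?_)
  beta_reduce
  rw [← integral_sub (hi2 z) hi1]
  refine integral_congr_ae (.of_forall fun x => ?_)
  ring

end

end

end PlugIn

namespace PlugIn

/-! ### Assouad's lower bound -/

noncomputable section

variable {d : ℕ} {ι : Type*} [Fintype ι]

/-- The function equal to `σ j * ε` on the cell `S j`, and to `0` off the cells. -/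
def cellFun (S : ι → Set (Feat d)) (ε : ℝ) (σ : ι → ℝ) (x : Feat d) : ℝ :=
  ∑ j, (S j).indicator (fun _ => σ j * ε) x

/-- The vector of signs encoded by a Boolean vector. -/
def signs (τ : ι → Bool) (j : ι) : ℝ := if τ j then 1 else -1

omit [Fintype ι] in
lemma signs_eq_or (τ : ι → Bool) (j : ι) : signs τ j = 1 ∨ signs τ j = -1 := by
  unfold signs; split_ifs <;> simp

omit [Fintype ι] in
lemma abs_signs (τ : ι → Bool) (j : ι) : |signs τ j| = 1 := by
  rcases signs_eq_or τ j with h | h <;> simp [h]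

section

variable {S : ι → Set (Feat d)} {ε : ℝ} {σ : ι → ℝ}

lemma sum_indicator_of_mem (hS : ∀ i j, i ≠ j → Disjoint (S i) (S j)) (g : ι → ℝ) {x : Feat d}
    {j : ι} (hx : x ∈ S j) : ∑ i, (S i).indicator (fun _ => g i) x = g j := by
  rw [Fintype.sum_eq_single j fun i hi => ?_, Set.indicator_of_mem hx]
  exact Set.indicator_of_notMem (fun h => Set.disjoint_left.1 (hS i j hi) h hx) _

lemma cellFun_of_mem (hS : ∀ i j, i ≠ j → Disjoint (S i) (S j)) {x : Feat d} {j : ι}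
    (hx : x ∈ S j) : cellFun S ε σ x = σ j * ε :=
  sum_indicator_of_mem hS _ hx

lemma cellFun_of_forall_notMem {x : Feat d} (hx : ∀ j, x ∉ S j) : cellFun S ε σ x = 0 :=
  Finset.sum_eq_zero fun j _ => Set.indicator_of_notMem (hx j) _

lemma measurable_cellFun (hSm : ∀ j, MeasurableSet (S j)) : Measurable (cellFun S ε σ) :=
  Finset.measurable_sum _ fun j _ => measurable_const.indicator (hSm j)

lemma abs_cellFun_le_one (hS : ∀ i j, i ≠ j → Disjoint (S i) (S j)) (hε0 : 0 ≤ ε) (hε1 : ε ≤ 1)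
    (hσ : ∀ j, |σ j| ≤ 1) (x : Feat d) : |cellFun S ε σ x| ≤ 1 := by
  by_cases hx : ∃ j, x ∈ S j
  · obtain ⟨j, hj⟩ := hx
    rw [cellFun_of_mem hS hj, abs_mul, abs_of_nonneg hε0]
    exact mul_le_one₀ (hσ j) hε0 hε1
  · rw [cellFun_of_forall_notMem (not_exists.1 hx)]
    simp

/-- The value `0` at `j` describes the midpoint of the two hypotheses that differ in the sign of
cell `j`. -/
lemma cellFun_update [DecidableEq ι] (j : ι) (s : ℝ) :
    cellFun S ε (Function.update σ j s)
      = cellFun S ε (Function.update σ j 0) + (S j).indicator (fun _ => s * ε) := by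
  ext x
  rw [Pi.add_apply, cellFun, cellFun, ← Finset.add_sum_erase _ _ (Finset.mem_univ j),
    ← Finset.add_sum_erase (a := j) _ (fun i => (S i).indicator
      (fun _ => Function.update σ j 0 i * ε) x) (Finset.mem_univ j)]
  have h : ∀ i ∈ Finset.univ.erase j, (S i).indicator (fun _ => Function.update σ j s i * ε) x
      = (S i).indicator (fun _ => Function.update σ j 0 i * ε) x := fun i hi => by
    rw [Function.update_of_ne (Finset.ne_of_mem_erase hi),
      Function.update_of_ne (Finset.ne_of_mem_erase hi)]
  rw [Finset.sum_congr rfl h]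
  simp
  ring

omit [Fintype ι] in
lemma abs_update_le_one [DecidableEq ι] (hσ : ∀ j, |σ j| ≤ 1) (j : ι) {s : ℝ} (hs : |s| ≤ 1)
    (i : ι) : |Function.update σ j s i| ≤ 1 := by
  rcases eq_or_ne i j with rfl | h
  · simpa using hs
  · simpa [h] using hσ i

end

section

variable {Q : Measure (Feat d)} [IsProbabilityMeasure Q] {S : ι → Set (Feat d)} {ε w : ℝ}
  {n : ℕ} {f : (Fin n → Obs d) → Feat d → Fin 2}

/-- The `Q`-mass of the part of the set `A` on which the decision `f z` is `1`. -/
def onesMass (Q : Measure (Feat d)) (A : Set (Feat d)) (f : (Fin n → Obs d) → Feat d → Fin 2)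
    (z : Fin n → Obs d) : ℝ :=
  ∫ x in A, (1 + labelSign (f z x)) / 2 ∂Q

lemma measurable_onesMass (hf : IsClassifier f) (A : Set (Feat d)) :
    Measurable (onesMass Q A f) := by
  have h : Measurable fun p : (Fin n → Obs d) × Feat d => (1 + labelSign (f p.1 p.2)) / 2 :=
    (measurable_const.add (measurable_labelSign.comp hf)).div_const 2
  exact h.stronglyMeasurable.integral_prod_right'.measurable

lemma integrable_labelSign_comp (hf : IsClassifier f) (z : Fin n → Obs d) (A : Set (Feat d)) :
    Integrable (fun x => labelSign (f z x)) (Q.restrict A) :=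
  integrable_of_abs_le (measurable_labelSign.comp (hf.comp measurable_prodMk_left)) (C := 1)
    fun _ => (abs_labelSign _).le

lemma onesMass_eq (hf : IsClassifier f) (A : Set (Feat d)) (z : Fin n → Obs d) :
    onesMass Q A f z = (Q.real A + ∫ x in A, labelSign (f z x) ∂Q) / 2 := by
  rw [onesMass, integral_div, integral_add (integrable_const _) (integrable_labelSign_comp hf z A)]
  simp

lemma onesMass_mem_Icc (hf : IsClassifier f) (A : Set (Feat d)) (z : Fin n → Obs d) :
    onesMass Q A f z ∈ Set.Icc 0 (Q.real A) := by
  have h : |∫ x in A, labelSign (f z x) ∂Q| ≤ Q.real A := by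
    have := norm_integral_le_of_norm_le_const (μ := Q.restrict A) (C := 1)
      (f := fun x => labelSign (f z x))
      (.of_forall fun x => (abs_labelSign (f z x)).le)
    simpa using this
  rw [onesMass_eq hf]
  have := abs_le.1 h
  constructor <;> linarith

/-- The two laws are `1 ± h` times the midpoint law, where `h` is the label sign times `ε` on cell
`j`. Then `h` has mean zero and second moment `ε² w`, and the two-point comparison applies to the
normalised statistic `onesMass / w`. -/
lemma integral_onesMass_sub_le [DecidableEq ι] (hf : IsClassifier f)
    (hSm : ∀ j, MeasurableSet (S j))
    (hS : ∀ i j, i ≠ j → Disjoint (S i) (S j)) (hε0 : 0 ≤ ε) (hε1 : ε ≤ 1) {σ : ι → ℝ}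
    (hσ : ∀ j, |σ j| ≤ 1) (hw : 0 < w) (j : ι) (hQ : Q.real (S j) = w)
    (hn : n * (ε ^ 2 * w) ≤ 1 / 24) :
    (∫ z, onesMass Q (S j) f z
        ∂(Measure.pi fun _ : Fin n => labelled Q (cellFun S ε (Function.update σ j 1))))
      - ∫ z, onesMass Q (S j) f z
        ∂(Measure.pi fun _ : Fin n => labelled Q (cellFun S ε (Function.update σ j (-1))))
      ≤ w / 2 := by
  set φ := cellFun S ε (Function.update σ j 0) with hφdef
  set ψ : Feat d → ℝ := (S j).indicator fun _ => ε with hψdef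
  have hφ : Measurable φ := measurable_cellFun hSm
  have hφ1 : ∀ x, |φ x| ≤ 1 :=
    abs_cellFun_le_one hS hε0 hε1 (abs_update_le_one hσ j (by simp))
  have hψ : Measurable ψ := measurable_const.indicator (hSm j)
  have hφψ : ∀ x, φ x * ψ x = 0 := fun x => by
    by_cases hx : x ∈ S j
    · rw [hφdef, cellFun_of_mem hS hx]; simp
    · simp [hψdef, hx]
  have hψ1 : ∀ x, |ψ x| ≤ 1 := fun x => by
    by_cases hx : x ∈ S j
    · simpa [hψdef, hx, abs_of_nonneg hε0] using hε1
    · simp [hψdef, hx]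
  set h : Obs d → ℝ := fun z => labelSign z.2 * ψ z.1 with hh
  have hm : Measurable h := measurable_labelSign_mul hψ
  have hb : ∀ z, |h z| ≤ 1 := fun z => (abs_labelSign_mul _ _).le.trans (hψ1 _)
  have := isProbabilityMeasure_labelled (Q := Q) hφ hφ1
  have h0 : ∫ z, h z ∂labelled Q φ = 0 := by
    rw [integral_labelled hφ hφ1 hm hb]
    refine integral_eq_zero_of_ae (.of_forall fun x => ?_)
    have := hφψ x
    simp only [hh, labelSign_zero, labelSign_one, Pi.zero_apply]
    linear_combination this
  have h2 : ∫ z, h z ^ 2 ∂labelled Q φ = ε ^ 2 * w := by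
    rw [integral_labelled hφ hφ1 (hm.pow_const 2) (C := 1) fun z => by
      rw [abs_pow]; exact pow_le_one₀ (abs_nonneg _) (hb z)]
    have : ∀ x, ((1 - φ x) * h (x, 0) ^ 2 + (1 + φ x) * h (x, 1) ^ 2) / 2
        = (S j).indicator (fun _ => ε ^ 2) x := fun x => by
      by_cases hx : x ∈ S j
      · simp [hh, hψdef, hx]; ring
      · simp [hh, hψdef, hx]
    simp_rw [this]
    rw [integral_indicator (hSm j)]
    simp [hQ, mul_comm]
  have hp : (labelled Q φ).withDensity (fun z => ENNReal.ofReal (1 + h z))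
      = labelled Q (cellFun S ε (Function.update σ j 1)) := by
    rw [labelled_withDensity hφ hφ1 hψ hφψ, cellFun_update j 1]
    simp [hφdef, hψdef]
  have hq : (labelled Q φ).withDensity (fun z => ENNReal.ofReal (1 - h z))
      = labelled Q (cellFun S ε (Function.update σ j (-1))) := by
    have := labelled_withDensity (Q := Q) hφ hφ1 hψ.neg fun x => by
      rw [Pi.neg_apply, mul_neg, hφψ, neg_zero]
    rw [cellFun_update j (-1)]
    have h3 : ((S j).indicator fun _ => -1 * ε) = -ψ := by
      ext x; by_cases hx : x ∈ S j <;> simp [hψdef, hx]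
    rw [h3, ← this]
    simp [hh, sub_eq_add_neg]
  have key := integral_sub_integral_perturbed_le (n := n) (labelled Q φ) hm hb h0
    (N := fun z => onesMass Q (S j) f z / w) ((measurable_onesMass hf _).div_const w) fun z => by
      have := onesMass_mem_Icc (Q := Q) hf (S j) z
      rw [hQ] at this
      exact ⟨div_nonneg this.1 hw.le, (div_le_one hw).2 this.2⟩
  rw [hp, hq, h2, integral_div, integral_div, ← sub_div, div_le_iff₀ hw] at key
  refine key.trans ?_
  have := one_add_pow_sub_one_sub_pow_le (by positivity) hn
  nlinarith

/-- The contribution of the cell `S j` to the excess risk. -/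
def cellLoss (Q : Measure (Feat d)) (S : ι → Set (Feat d)) (ε : ℝ)
    (f : (Fin n → Obs d) → Feat d → Fin 2) (σ : ι → ℝ) (j : ι) : ℝ :=
  ∫ z, ∫ x in S j, (1 - σ j * labelSign (f z x)) / 2 ∂Q
    ∂(Measure.pi fun _ : Fin n => labelled Q (cellFun S ε σ))

/-- Under the sign `+1` the loss is `w` minus the expected `onesMass`, under `-1` it is the expected
`onesMass`. Their sum is `w` minus a difference that is at most `w / 2`. -/
lemma half_le_cellLoss_add [DecidableEq ι] (hf : IsClassifier f)
    (hSm : ∀ j, MeasurableSet (S j))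
    (hS : ∀ i j, i ≠ j → Disjoint (S i) (S j)) (hε0 : 0 ≤ ε) (hε1 : ε ≤ 1) {σ : ι → ℝ}
    (hσ : ∀ j, |σ j| ≤ 1) (hw : 0 < w) (j : ι) (hQ : Q.real (S j) = w)
    (hn : n * (ε ^ 2 * w) ≤ 1 / 24) :
    w / 2 ≤ cellLoss Q S ε f (Function.update σ j 1) j
      + cellLoss Q S ε f (Function.update σ j (-1)) j := by
  have key := integral_onesMass_sub_le (Q := Q) hf hSm hS hε0 hε1 hσ hw j hQ hn
  have hprob := isProbabilityMeasure_labelled (Q := Q) (measurable_cellFun (ε := ε)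
    (σ := Function.update σ j 1) hSm)
    (abs_cellFun_le_one hS hε0 hε1 (abs_update_le_one hσ j (by simp)))
  have h1 : ∀ z, ∫ x in S j, (1 - 1 * labelSign (f z x)) / 2 ∂Q = w - onesMass Q (S j) f z := by
    intro z
    rw [onesMass_eq hf, integral_div]
    simp_rw [one_mul]
    rw [integral_sub (integrable_const _) (integrable_labelSign_comp hf z _)]
    simp [hQ]
    ring
  have h2 : ∀ z, ∫ x in S j, (1 - -1 * labelSign (f z x)) / 2 ∂Q = onesMass Q (S j) f z := by
    intro z
    simp [onesMass]
  unfold cellLoss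
  simp only [Function.update_self, h1, h2]
  rw [integral_sub (integrable_const _) (integrable_of_abs_le (measurable_onesMass hf _)
    (C := Q.real (S j)) fun z => ?_)]
  · simp
    linarith
  · have := onesMass_mem_Icc (Q := Q) hf (S j) z
    rw [abs_of_nonneg this.1]; exact this.2

lemma excessRisk_cellFun (hf : IsClassifier f) (hSm : ∀ j, MeasurableSet (S j))
    (hS : ∀ i j, i ≠ j → Disjoint (S i) (S j)) (hε0 : 0 ≤ ε) (hε1 : ε ≤ 1) (τ : ι → Bool) :
    excessRisk (labelledProb Q (cellFun S ε (signs τ)) (measurable_cellFun hSm)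
        (abs_cellFun_le_one hS hε0 hε1 fun j => (abs_signs τ j).le)) f
      = ε * ∑ j, cellLoss Q S ε f (signs τ) j := by
  have hprob := isProbabilityMeasure_labelled (Q := Q) (measurable_cellFun (ε := ε)
    (σ := signs τ) hSm) (abs_cellFun_le_one hS hε0 hε1 fun j => (abs_signs τ j).le)
  rw [excessRisk_labelledProb _ _ hf]
  have hbd : ∀ j y, |(1 - signs τ j * labelSign y) / 2| ≤ 1 := fun j y => by
    have : |signs τ j * labelSign y| = 1 := by rw [abs_mul, abs_signs, abs_labelSign, one_mul]
    have := abs_le.1 this.le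
    rw [abs_le]; constructor <;> linarith
  have hm : ∀ j, Measurable fun p : (Fin n → Obs d) × Feat d =>
      (1 - signs τ j * labelSign (f p.1 p.2)) / 2 := fun j =>
    (measurable_const.sub (measurable_const.mul (measurable_labelSign.comp hf))).div_const 2
  have hi : ∀ j z, Integrable (fun x => (1 - signs τ j * labelSign (f z x)) / 2) Q := fun j z =>
    integrable_of_abs_le ((hm j).comp measurable_prodMk_left) (C := 1) fun x => hbd _ _
  have hpt : ∀ z x, (|cellFun S ε (signs τ) x| - labelSign (f z x) * cellFun S ε (signs τ) x) / 2
      = ∑ j, ε * (S j).indicator (fun x => (1 - signs τ j * labelSign (f z x)) / 2) x := by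
    intro z x
    by_cases hx : ∃ j, x ∈ S j
    · obtain ⟨j, hj⟩ := hx
      rw [cellFun_of_mem hS hj, Fintype.sum_eq_single j fun i hi => ?_, Set.indicator_of_mem hj,
        abs_mul, abs_signs, abs_of_nonneg hε0]
      · ring
      · rw [Set.indicator_of_notMem (fun h => Set.disjoint_left.1 (hS i j hi) h hj), mul_zero]
    · rw [cellFun_of_forall_notMem (not_exists.1 hx), Finset.sum_eq_zero fun j _ => ?_]
      · simp
      · rw [Set.indicator_of_notMem (not_exists.1 hx j), mul_zero]
  have hz : ∀ z, ∫ x, (|cellFun S ε (signs τ) x|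
        - labelSign (f z x) * cellFun S ε (signs τ) x) / 2 ∂Q
      = ∑ j, ε * ∫ x in S j, (1 - signs τ j * labelSign (f z x)) / 2 ∂Q := fun z => by
    simp_rw [hpt z]
    rw [integral_finsetSum _ fun j _ => ((hi j z).indicator (hSm j)).const_mul ε]
    refine Finset.sum_congr rfl fun j _ => ?_
    rw [integral_const_mul, integral_indicator (hSm j)]
  simp_rw [hz]
  rw [integral_finsetSum _ fun j _ => ?_, Finset.mul_sum]
  · refine Finset.sum_congr rfl fun j _ => ?_
    rw [integral_const_mul, cellLoss]
  · refine Integrable.const_mul (Integrable.of_bound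
      ((hm j).stronglyMeasurable.integral_prod_right'.aestronglyMeasurable) 1
      (.of_forall fun z => ?_)) ε
    refine (norm_integral_le_of_norm_le_const (.of_forall fun x => hbd _ _)).trans ?_
    simp

omit [Fintype ι] in
lemma signs_update [DecidableEq ι] (τ : ι → Bool) (j : ι) (b : Bool) :
    signs (Function.update τ j b) = Function.update (signs τ) j (if b then 1 else -1) := by
  ext i
  rcases eq_or_ne i j with rfl | h
  · simp [signs]
  · simp [signs, h]

/-- Averaging over the hypercube: for each `j`, pairing every `τ` with its flip at `j` gives a mean
loss of at least `w / 4` on cell `j`. Some vertex is at least as bad as the average of the sums over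
the cells. -/
lemma exists_le_excessRisk_cellFun (hf : IsClassifier f) (hSm : ∀ j, MeasurableSet (S j))
    (hS : ∀ i j, i ≠ j → Disjoint (S i) (S j)) (hε0 : 0 ≤ ε) (hε1 : ε ≤ 1)
    (hw : 0 < w) (hQ : ∀ j, Q.real (S j) = w) (hn : n * (ε ^ 2 * w) ≤ 1 / 24) :
    ∃ τ : ι → Bool, ε * (Fintype.card ι * (w / 4)) ≤
      excessRisk (labelledProb Q (cellFun S ε (signs τ)) (measurable_cellFun hSm)
        (abs_cellFun_le_one hS hε0 hε1 fun j => (abs_signs τ j).le)) f := by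
  classical
  have hj : ∀ j, ∑ _τ : ι → Bool, w / 4 ≤ ∑ τ : ι → Bool, cellLoss Q S ε f (signs τ) j := by
    intro j
    have hinv : Function.Involutive fun τ : ι → Bool => Function.update τ j (!τ j) := by
      intro τ; simp
    have h1 : ∑ τ : ι → Bool, cellLoss Q S ε f (signs (Function.update τ j (!τ j))) j
        = ∑ τ : ι → Bool, cellLoss Q S ε f (signs τ) j :=
      Equiv.sum_comp (hinv.toPerm _) fun τ => cellLoss Q S ε f (signs τ) j
    have h2 : ∑ _τ : ι → Bool, w / 2 ≤ ∑ τ : ι → Bool, (cellLoss Q S ε f (signs τ) j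
        + cellLoss Q S ε f (signs (Function.update τ j (!τ j))) j) := by
      refine Finset.sum_le_sum fun τ _ => ?_
      have h3 := half_le_cellLoss_add (Q := Q) hf hSm hS hε0 hε1 (σ := signs τ)
        (fun j => (abs_signs τ j).le) hw j (hQ j) hn
      -- The pair consists of `τ` and its flip; which of them carries `+1` depends on `τ j`.
      have h4 : signs τ = Function.update (signs τ) j (signs τ j) := by simp
      rw [signs_update]
      by_cases hτ : τ j
      · have h5 : signs τ j = 1 := by simp [signs, hτ]
        rw [h5] at h4
        rw [← h4] at h3
        simpa [hτ] using h3
      · have h5 : signs τ j = -1 := by simp [signs, hτ]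
        rw [h5] at h4
        rw [← h4, add_comm] at h3
        simpa [hτ] using h3
    rw [Finset.sum_add_distrib, h1] at h2
    simp only [Finset.sum_const, nsmul_eq_mul] at h2 ⊢
    linarith
  have hsum : ∑ _τ : ι → Bool, (Fintype.card ι * (w / 4))
      ≤ ∑ τ : ι → Bool, ∑ j, cellLoss Q S ε f (signs τ) j := by
    rw [Finset.sum_comm]
    calc _ = ∑ _j : ι, ∑ _τ : ι → Bool, w / 4 := by
          rw [Finset.sum_comm]; simp
      _ ≤ _ := Finset.sum_le_sum fun j _ => hj j
  obtain ⟨τ, -, hτ⟩ := Finset.exists_le_of_sum_le Finset.univ_nonempty hsum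
  refine ⟨τ, ?_⟩
  rw [excessRisk_cellFun hf hSm hS hε0 hε1]
  gcongr

end

end

end PlugIn

namespace PlugIn

/-! ### Packing of regular sets -/

section Packing

variable {d : ℕ}

lemma volume_real_closedBall (x : Feat d) {r : ℝ} (hr : 0 ≤ r) :
    volume.real (Metric.closedBall x r) = r ^ d * volume.real (Metric.ball (0 : Feat d) 1) := by
  rw [Measure.real, Measure.addHaar_closedBall _ _ hr, ENNReal.toReal_mul,
    ENNReal.toReal_ofReal (by positivity), finrank_euclideanSpace_fin, Measure.real]

lemma volume_real_unitBall_pos : 0 < volume.real (Metric.ball (0 : Feat d) 1) :=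
  ENNReal.toReal_pos (Metric.measure_ball_pos _ _ one_pos).ne' measure_ball_lt_top.ne

lemma IsRegularSet.le_volume_real {c₀ r₀ : ℝ} {A : Set (Feat d)} (hA : IsRegularSet c₀ r₀ A)
    (hc₀ : 0 < c₀) {x : Feat d} (hx : x ∈ A) {r : ℝ} (hr : 0 < r) (hr₀ : r ≤ r₀) :
    c₀ * (r ^ d * volume.real (Metric.ball (0 : Feat d) 1))
      ≤ volume.real (A ∩ Metric.closedBall x r) := by
  have h := ENNReal.toReal_mono
    (ne_top_of_le_ne_top measure_closedBall_lt_top.ne (measure_mono Set.inter_subset_right))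
    (hA.2 x hx r hr hr₀)
  rw [ENNReal.toReal_mul, ENNReal.toReal_ofReal hc₀.le] at h
  rw [← volume_real_closedBall x hr.le]
  exact h

/-- A maximal `r`-separated subset is automatically an `r`-cover. It is finite because its
cardinality is at most that of a finite cover at scale `r / 2`. -/
lemma exists_separated_cover {X : Type*} [MetricSpace X] {B : Set X} (hB : IsCompact B) {r : ℝ}
    (hr : 0 < r) : ∃ F : Finset X, ↑F ⊆ B ∧ (∀ x ∈ F, ∀ y ∈ F, x ≠ y → r < dist x y) ∧
      B ⊆ ⋃ x ∈ F, Metric.closedBall x r := by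
  set e : NNReal := (r / 2).toNNReal with he
  have h2 : ((2 * e : NNReal) : ℝ) = r := by
    rw [NNReal.coe_mul, he, Real.coe_toNNReal _ (by positivity), NNReal.coe_ofNat]
    ring
  have hepos : e ≠ 0 := (Real.toNNReal_pos.2 (by positivity)).ne'
  obtain ⟨N, -, hN, hcov⟩ := Metric.exists_finite_isCover_of_isCompact hepos hB
  have hfin : Metric.packingNumber (2 * e) B ≠ ⊤ := by
    refine ne_top_of_le_ne_top ?_ ((Metric.packingNumber_two_mul_le_externalCoveringNumber e B).trans
      hcov.externalCoveringNumber_le_encard)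
    exact hN.encard_lt_top.ne
  set M := Metric.maximalSeparatedSet (2 * e) B with hM
  have hMfin : M.Finite := by
    rw [← Set.encard_ne_top_iff, hM, Metric.encard_maximalSeparatedSet hfin]
    exact hfin
  refine ⟨hMfin.toFinset, by simpa using Metric.maximalSeparatedSet_subset, ?_, ?_⟩
  · intro x hx y hy hxy
    have h := Metric.isSeparated_maximalSeparatedSet (hMfin.mem_toFinset.1 hx)
      (hMfin.mem_toFinset.1 hy) hxy
    beta_reduce at h
    rw [edist_dist, ← ENNReal.ofReal_coe_nnreal, h2, ENNReal.ofReal_lt_ofReal_iff_of_nonneg hr.le]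
      at h
    exact h
  · have h := Metric.isCover_iff_subset_iUnion_closedBall.1 (Metric.isCover_maximalSeparatedSet hfin)
    rw [h2] at h
    simpa using h

/-- Volume comparison: regularity at `x₀` bounds the volume of `A` near `x₀` from below, and the
`r`-balls about a maximal separated set cover that part of `A`. -/
lemma IsRegularSet.exists_packing {c₀ r₀ : ℝ} {A : Set (Feat d)} (hA : IsRegularSet c₀ r₀ A)
    (hAc : IsCompact A) (hc₀ : 0 < c₀) {x₀ : Feat d} (hx₀ : x₀ ∈ A) {ρ : ℝ} (hρ : 0 < ρ)
    (hρ₀ : ρ ≤ r₀) {r : ℝ} (hr : 0 < r) :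
    ∃ F : Finset (Feat d), ↑F ⊆ A ∩ Metric.closedBall x₀ ρ ∧
      (∀ x ∈ F, ∀ y ∈ F, x ≠ y → r < dist x y) ∧ c₀ * ρ ^ d ≤ F.card * r ^ d := by
  obtain ⟨F, hF, hsep, hcov⟩ := exists_separated_cover
    (hAc.inter_right (Metric.isClosed_closedBall (x := x₀) (ε := ρ))) hr
  refine ⟨F, hF, hsep, ?_⟩
  have h1 := hA.le_volume_real hc₀ hx₀ hρ hρ₀
  have h2 : volume.real (A ∩ Metric.closedBall x₀ ρ)
      ≤ ∑ x ∈ F, volume.real (Metric.closedBall x r) := by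
    refine (measureReal_mono hcov ?_).trans (measureReal_biUnion_finset_le _ _)
    exact ((measure_biUnion_finset_le _ _).trans_lt
      (ENNReal.sum_lt_top.2 fun x _ => measure_closedBall_lt_top)).ne
  simp_rw [volume_real_closedBall _ hr.le] at h2
  rw [Finset.sum_const, nsmul_eq_mul] at h2
  have h3 := h1.trans h2
  rw [← mul_assoc, ← mul_assoc] at h3
  exact le_of_mul_le_mul_right h3 volume_real_unitBall_pos

end Packing

/-! ### Piecewise constant densities -/

section Density

variable {E κ : Type*} [MeasurableSpace E] [Fintype κ]

/-- The density is the constant `p k / ν (T k)` on `T k` and zero elsewhere. -/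
lemma exists_density {ν : Measure E} {T : κ → Set E} (hT : ∀ k, MeasurableSet (T k))
    (hdis : ∀ i j, i ≠ j → Disjoint (T i) (T j)) (hfin : ∀ k, ν (T k) ≠ ⊤)
    {p : κ → ℝ} (hp : ∀ k, 0 ≤ p k) (hsum : ∑ k, p k = 1) {K : ℝ}
    (hpos : ∀ k, 0 < ν.real (T k)) (hK : 0 ≤ K) (hle : ∀ k, p k ≤ K * ν.real (T k)) :
    ∃ μ : E → ℝ, Measurable μ ∧ (∀ x, 0 ≤ μ x) ∧ (∀ x, μ x ≤ K) ∧
      IsProbabilityMeasure (ν.withDensity fun x => ENNReal.ofReal (μ x)) ∧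
      (∀ k, (ν.withDensity fun x => ENNReal.ofReal (μ x)).real (T k) = p k) ∧
      (ν.withDensity fun x => ENNReal.ofReal (μ x)) (⋃ k, T k)ᶜ = 0 := by
  set q : κ → ℝ := fun k => p k / ν.real (T k) with hq
  have hq0 : ∀ k, 0 ≤ q k := fun k => div_nonneg (hp k) (hpos k).le
  set μ : E → ℝ := fun x => ∑ k, (T k).indicator (fun _ => q k) x with hμ
  have hμm : Measurable μ := Finset.measurable_sum _ fun k _ => measurable_const.indicator (hT k)
  have hμmem : ∀ k x, x ∈ T k → μ x = q k := fun k x hx => by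
    rw [hμ]
    beta_reduce
    rw [Fintype.sum_eq_single k fun i hi => ?_, Set.indicator_of_mem hx]
    exact Set.indicator_of_notMem (fun h => Set.disjoint_left.1 (hdis i k hi) h hx) _
  have hμoff : ∀ x, (∀ k, x ∉ T k) → μ x = 0 := fun x hx =>
    Finset.sum_eq_zero fun k _ => Set.indicator_of_notMem (hx k) _
  set Q := ν.withDensity fun x => ENNReal.ofReal (μ x) with hQ
  have hQT : ∀ k, Q (T k) = ENNReal.ofReal (p k) := fun k => by
    rw [hQ, withDensity_apply _ (hT k),
      setLIntegral_congr_fun (hT k) (fun x hx => by rw [hμmem k x hx]), setLIntegral_const,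
      ← ENNReal.ofReal_toReal (hfin k), ← ENNReal.ofReal_mul (hq0 k)]
    congr 1
    exact div_mul_cancel₀ _ (hpos k).ne'
  have hQoff : Q (⋃ k, T k)ᶜ = 0 := by
    have hm : MeasurableSet (⋃ k, T k)ᶜ := (MeasurableSet.iUnion hT).compl
    rw [hQ, withDensity_apply _ hm, setLIntegral_congr_fun (g := fun _ => 0) hm (fun x hx => ?_)]
    · exact lintegral_zero
    · rw [hμoff x fun k hk => hx (Set.mem_iUnion.2 ⟨k, hk⟩), ENNReal.ofReal_zero]
  refine ⟨μ, hμm, fun x => Finset.sum_nonneg fun k _ => Set.indicator_nonneg (fun _ _ => hq0 k) _,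
    fun x => ?_, ⟨?_⟩, fun k => ?_, hQoff⟩
  · by_cases hx : ∃ k, x ∈ T k
    · obtain ⟨k, hk⟩ := hx
      rw [hμmem k x hk]
      exact (div_le_iff₀ (hpos k)).2 (hle k)
    · rw [hμoff x (not_exists.1 hx)]
      exact hK
  · rw [← Set.union_compl_self (⋃ k, T k), measure_union disjoint_compl_right
      (MeasurableSet.iUnion hT).compl, hQoff, add_zero,
      measure_iUnion (fun i j h => hdis i j h) hT, tsum_fintype]
    rw [Finset.sum_congr rfl fun k _ => hQT k]
    rw [← ENNReal.ofReal_sum_of_nonneg fun k _ => hp k, hsum, ENNReal.ofReal_one]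
  · rw [Measure.real, hQT, ENNReal.toReal_ofReal (hp k)]

end Density

end PlugIn

namespace PlugIn

/-! ### The hypotheses form a subset of the class -/

section Membership

variable {d : ℕ} {ι : Type*} [Fintype ι]

/-- The regular version is `1/2` plus the rescaled bump sum. It need agree with the regression
function only where `Q` has mass: on the cells the bumps equal `1`, and on `R` they have already
vanished. -/
lemma regressionHolder_labelledProb {Q : Measure (Feat d)} [IsProbabilityMeasure Q]
    {S : ι → Set (Feat d)} {b : ℝ} {σ : ι → ℝ} {β L M r : ℝ} {u : Feat d → ℝ}
    {c : ι → Feat d} {R : Set (Feat d)}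
    (hφ : Measurable (cellFun S (2 * b) σ)) (hφ1 : ∀ x, |cellFun S (2 * b) σ x| ≤ 1)
    (hS : ∀ i j, i ≠ j → Disjoint (S i) (S j))
    (hβ : 0 < β) (hr : 0 < r) (hb0 : 0 ≤ b) (hb : b ≤ 1 / 2) (hσ : ∀ j, |σ j| ≤ 1)
    (hu : ∀ n : ℕ, ContDiff ℝ n u) (hu01 : ∀ x, u x ∈ Set.Icc (0 : ℝ) 1)
    (hone : ∀ x, ‖x‖ ≤ 1 → u x = 1) (hsupp : tsupport u ⊆ Metric.closedBall 0 2)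
    (hM : ∀ k ≤ strictFloor β + 1, ∀ y, ‖iteratedFDeriv ℝ k u y‖ ≤ M)
    (hbL : b * ((strictFloor β + 2) * M) ≤ L * r ^ β)
    (hc : ∀ i j, i ≠ j → 4 * r < dist (c i) (c j))
    (hSc : ∀ j, S j ⊆ Metric.closedBall (c j) r)
    (hR : ∀ x ∈ R, ∀ j, 2 * r < dist x (c j)) (hQ : Q (R ∪ ⋃ j, S j)ᶜ = 0) :
    RegressionHolder β L (labelledProb Q (cellFun S (2 * b) σ) hφ hφ1) := by
  have hdist : ∀ x y : Feat d, dist (r⁻¹ • x) (r⁻¹ • y) = r⁻¹ * dist x y := fun x y => by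
    rw [dist_smul₀, Real.norm_of_nonneg (inv_nonneg.2 hr.le)]
  have hc' : ∀ i j, i ≠ j → 4 < dist (r⁻¹ • c i) (r⁻¹ • c j) := fun i j hij => by
    rw [hdist, ← div_eq_inv_mul, lt_div_iff₀ hr]
    exact hc i j hij
  refine ⟨fun y => 1 / 2 + b * bumpSum u (fun j => r⁻¹ • c j) σ (r⁻¹ • y), ?_, fun x => ?_, ?_⟩
  · refine const_add_mul_comp_smul_mem_holderClass hβ hr (bumpSum_contDiff _ (hu _)) (M := M)
      (fun k hk => norm_iteratedFDeriv_bumpSum_le (hu k) hsupp hc' hσ (hM k hk)) ?_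
    rwa [abs_of_nonneg hb0]
  · have h1 := abs_le.1 (abs_bumpSum_le_one hu01 (hu 0) hsupp hc' hσ (r⁻¹ • x))
    constructor <;> nlinarith
  · rw [marginalX_labelledProb]
    have hQ' : ∀ᵐ x ∂Q, x ∈ R ∪ ⋃ j, S j := hQ
    filter_upwards [regression_labelledProb (Q := Q) hφ hφ1, hQ'] with x hx hxT
    rw [hx]
    by_cases hxS : ∃ j, x ∈ S j
    · obtain ⟨j, hj⟩ := hxS
      rw [cellFun_of_mem hS hj, bumpSum_of_dist_le_one hone hsupp hc' (j := j)]
      · ring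
      · rw [hdist, ← div_eq_inv_mul, div_le_one hr]
        exact hSc j hj
    · have hxR : x ∈ R := hxT.resolve_right fun h => hxS (Set.mem_iUnion.1 h)
      rw [cellFun_of_forall_notMem (not_exists.1 hxS), bumpSum_of_forall_two_lt_dist hsupp]
      · simp
      · intro j
        rw [hdist, ← div_eq_inv_mul, lt_div_iff₀ hr]
        exact hR x hxR j

/-- Almost surely `|η - 1/2|` is `0` or `b`. The event is null for `t < b`, and otherwise it is
contained, up to a null set, in the union of the cells. -/
lemma marginAssumption_labelledProb {Q : Measure (Feat d)} [IsProbabilityMeasure Q]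
    {S : ι → Set (Feat d)} {b w α C₀ : ℝ} {σ : ι → ℝ}
    (hφ : Measurable (cellFun S (2 * b) σ)) (hφ1 : ∀ x, |cellFun S (2 * b) σ x| ≤ 1)
    (hS : ∀ i j, i ≠ j → Disjoint (S i) (S j)) (hα : 0 < α) (hC₀ : 0 < C₀) (hb : 0 < b)
    (hσ : ∀ j, |σ j| = 1) (hQ : ∀ j, Q.real (S j) = w)
    (hw : Fintype.card ι * w ≤ C₀ * b ^ α) :
    MarginAssumption α C₀ (labelledProb Q (cellFun S (2 * b) σ) hφ hφ1) := by
  intro t ht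
  rw [marginalX_labelledProb]
  set P := labelledProb Q (cellFun S (2 * b) σ) hφ hφ1
  have hae : ∀ᵐ x ∂Q, 0 < |regression P x - 1 / 2| ∧ |regression P x - 1 / 2| ≤ t →
      x ∈ ⋃ j, S j ∧ b ≤ t := by
    filter_upwards [regression_labelledProb (Q := Q) hφ hφ1] with x hx h
    rw [hx] at h
    by_cases hxS : ∃ j, x ∈ S j
    · obtain ⟨j, hj⟩ := hxS
      rw [cellFun_of_mem hS hj] at h
      have e : (1 + σ j * (2 * b)) / 2 - 1 / 2 = σ j * b := by ring
      rw [e, abs_mul, hσ, one_mul, abs_of_pos hb] at h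
      exact ⟨Set.mem_iUnion.2 ⟨j, hj⟩, h.2⟩
    · rw [cellFun_of_forall_notMem (not_exists.1 hxS)] at h
      norm_num at h
  rcases lt_or_ge t b with htb | htb
  · have h0 : Q {x | 0 < |regression P x - 1 / 2| ∧ |regression P x - 1 / 2| ≤ t} = 0 :=
      measure_eq_zero_iff_ae_notMem.2 (hae.mono fun x hx h => absurd (hx h).2 (not_le.2 htb))
    rw [Measure.real, h0, ENNReal.toReal_zero]
    positivity
  · calc _ ≤ Q.real (⋃ j, S j) := ENNReal.toReal_mono (measure_ne_top _ _)
          (measure_mono_ae (hae.mono fun x hx h => (hx h).1))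
      _ ≤ ∑ j, Q.real (S j) := measureReal_iUnion_fintype_le _
      _ = Fintype.card ι * w := by simp [hQ]
      _ ≤ C₀ * b ^ α := hw
      _ ≤ C₀ * t ^ α := by gcongr

end Membership

/-! ### The lower bound at a given scale -/

section Scale

variable {d : ℕ}

/-- The slack in the strict inequality `K λ(A) > 1` pays for the removal of a small ball; what is
left can still carry a probability of density at most `K`. -/
lemma exists_radius {A : Set (Feat d)} (hd : 1 ≤ d) (hAc : IsCompact A) {K r₀ : ℝ} (hK : 0 < K)
    (hr₀ : 0 < r₀) (hA : 1 < ENNReal.ofReal K * volume A) (x₀ : Feat d) :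
    ∃ ρ : ℝ, 0 < ρ ∧ ρ ≤ r₀ ∧ 1 ≤ K * volume.real (A \ Metric.closedBall x₀ (2 * ρ)) := by
  set v := volume.real (Metric.ball (0 : Feat d) 1) with hv
  have hvpos : 0 < v := volume_real_unitBall_pos
  have h1 : 1 < K * volume.real A := by
    have := (ENNReal.toReal_lt_toReal ENNReal.one_ne_top
      (ENNReal.mul_ne_top ENNReal.ofReal_ne_top hAc.measure_lt_top.ne)).2 hA
    rwa [ENNReal.toReal_mul, ENNReal.toReal_ofReal hK.le, ENNReal.toReal_one] at this
  set δ := K * volume.real A - 1 with hδ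
  have hδpos : 0 < δ := by linarith
  set ρ := min r₀ (min (1 / 2) (δ / (2 * K * v))) with hρ
  have hρpos : 0 < ρ := by positivity
  have hρ1 : ρ ≤ 1 / 2 := (min_le_right _ _).trans (min_le_left _ _)
  have hρ2 : ρ * (2 * K * v) ≤ δ :=
    (le_div_iff₀ (by positivity)).1 ((min_le_right _ _).trans (min_le_right _ _))
  refine ⟨ρ, hρpos, min_le_left _ _, ?_⟩
  have h2 : volume.real A ≤ volume.real (A \ Metric.closedBall x₀ (2 * ρ))
      + volume.real (Metric.closedBall x₀ (2 * ρ)) := by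
    refine (measureReal_mono (s₂ := A \ Metric.closedBall x₀ (2 * ρ) ∪
      Metric.closedBall x₀ (2 * ρ)) (by rw [Set.sdiff_union_self]; exact Set.subset_union_left)
      (measure_union_lt_top ?_ measure_closedBall_lt_top).ne).trans (measureReal_union_le _ _)
    exact (measure_mono Set.sdiff_subset).trans_lt hAc.measure_lt_top
  rw [volume_real_closedBall _ (by positivity)] at h2
  -- Here `d ≥ 1` and `2ρ ≤ 1` make the ball volume at most linear in `ρ`.
  have h3 : (2 * ρ) ^ d ≤ 2 * ρ :=
    pow_le_of_le_one (by positivity) (by linarith) (by omega)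
  have h4 : K * ((2 * ρ) ^ d * v) ≤ δ := by
    calc _ ≤ K * ((2 * ρ) * v) := by gcongr
      _ = ρ * (2 * K * v) := by ring
      _ ≤ δ := hρ2
  have h5 := mul_le_mul_of_nonneg_left h2 hK.le
  rw [mul_add] at h5
  linarith

lemma disjoint_inter_closedBall {ι : Type*} {c : ι → Feat d} {r : ℝ} (hr : 0 < r)
    (hc : ∀ i j, i ≠ j → 4 * r < dist (c i) (c j)) (A : Set (Feat d)) (i j : ι) (hij : i ≠ j) :
    Disjoint (A ∩ Metric.closedBall (c i) r) (A ∩ Metric.closedBall (c j) r) := by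
  refine Set.disjoint_left.2 fun x hi hj => ?_
  have h1 : dist x (c i) ≤ r := hi.2
  have h2 : dist x (c j) ≤ r := hj.2
  linarith [dist_triangle_left (c i) (c j) x, hc i j hij]

/-- The cells get equal masses although their volumes may differ. Regularity at the centres bounds
every cell volume below, which keeps the densities under `K`; the leftover mass, at most `1`, fits
on the far part. -/
lemma IsRegularSet.exists_marginal {ι : Type*} [Fintype ι] {c₀ r₀ K r w : ℝ} {A : Set (Feat d)}
    (hA : IsRegularSet c₀ r₀ A) (hAc : IsCompact A) (hc₀ : 0 < c₀) (hK : 0 < K)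
    {c : ι → Feat d} (hcA : ∀ j, c j ∈ A) (hr : 0 < r) (hr₀ : r ≤ r₀)
    (hc : ∀ i j, i ≠ j → 4 * r < dist (c i) (c j)) {x₀ : Feat d} {ρ : ℝ}
    (hR : ∀ x ∈ A \ Metric.closedBall x₀ (2 * ρ), ∀ j, 2 * r < dist x (c j))
    (hw : 0 < w) (hw1 : Fintype.card ι * w ≤ 1)
    (hwK : w ≤ K * (c₀ * (r ^ d * volume.real (Metric.ball (0 : Feat d) 1))))
    (hρA : 1 ≤ K * volume.real (A \ Metric.closedBall x₀ (2 * ρ))) :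
    ∃ Q : Measure (Feat d), IsProbabilityMeasure Q ∧ ∃ μ : Feat d → ℝ, Measurable μ ∧
      (∀ x, 0 ≤ μ x) ∧ (∀ x, μ x ≤ K) ∧
      Q = volume.withDensity (fun x => ENNReal.ofReal (μ x)) ∧
      (∀ j, Q.real (A ∩ Metric.closedBall (c j) r) = w) ∧
      Q (A \ Metric.closedBall x₀ (2 * ρ) ∪ ⋃ j, A ∩ Metric.closedBall (c j) r)ᶜ = 0 := by
  have hv := volume_real_unitBall_pos (d := d)
  set R := A \ Metric.closedBall x₀ (2 * ρ)
  let S : ι → Set (Feat d) := fun j => A ∩ Metric.closedBall (c j) r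
  have hRS : ∀ j, Disjoint R (S j) := fun j => Set.disjoint_left.2 fun x hx hj => by
    have h1 := hR x hx j
    have h2 : dist x (c j) ≤ r := hj.2
    linarith
  have hSvol : ∀ j, c₀ * (r ^ d * volume.real (Metric.ball (0 : Feat d) 1)) ≤ volume.real (S j) :=
    fun j => hA.le_volume_real hc₀ (hcA j) hr hr₀
  let T : Option ι → Set (Feat d) := fun k => k.elim R S
  let p : Option ι → ℝ := fun k => k.elim (1 - Fintype.card ι * w) fun _ => w
  have hTA : ∀ k, T k ⊆ A := by
    rintro (_ | j)
    · exact Set.sdiff_subset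
    · exact Set.inter_subset_left
  have hTm : ∀ k, MeasurableSet (T k) := by
    rintro (_ | j)
    · exact hAc.measurableSet.diff measurableSet_closedBall
    · exact hAc.measurableSet.inter measurableSet_closedBall
  have hTd : ∀ i j, i ≠ j → Disjoint (T i) (T j) := by
    rintro (_ | i) (_ | j) h
    · exact absurd rfl h
    · exact hRS j
    · exact (hRS i).symm
    · exact disjoint_inter_closedBall hr hc A i j fun e => h (congrArg some e)
  have hp : ∀ k, 0 ≤ p k := by
    rintro (_ | j)
    · exact sub_nonneg.2 hw1
    · exact hw.le
  have hTpos : ∀ k, 0 < volume.real (T k) := by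
    rintro (_ | j)
    · exact pos_of_mul_pos_right (zero_lt_one.trans_le hρA) hK.le
    · exact lt_of_lt_of_le (by positivity) (hSvol j)
  have hle : ∀ k, p k ≤ K * volume.real (T k) := by
    rintro (_ | j)
    · exact le_trans (sub_le_self _ (by positivity)) hρA
    · exact hwK.trans (mul_le_mul_of_nonneg_left (hSvol j) hK.le)
  obtain ⟨μ, hμm, hμ0, hμK, hQ, hQT, hQoff⟩ := exists_density hTm hTd
    (fun k => ((measure_mono (hTA k)).trans_lt hAc.measure_lt_top).ne) hp
    (by simp [p, Fintype.sum_option]) hTpos hK.le hle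
  have hTU : ⋃ k, T k = R ∪ ⋃ j, S j := by
    ext x
    simp [T, Option.exists]
  exact ⟨_, hQ, μ, hμm, hμ0, hμK, rfl, fun j => hQT (some j), by rw [← hTU]; exact hQoff⟩

/-- The single constant `κ` meets four demands: total cell mass at most `1`, the margin bound (`κ ≤
C₀`), the density bound on the cells, and indistinguishability, where `96 = 4 * 24`. -/
lemma le_worstExcessRisk_of_scale {n : ℕ} {L β α c₀ r₀ C₀ K M ρ r a κ : ℝ}
    (hβ : 0 < β) (hα : 0 < α) (hc₀ : 0 < c₀) (hC₀ : 0 < C₀) (hK : 0 < K)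
    {A A' : Set (Feat d)} (hAA' : A ⊆ A') (hAc : IsCompact A) (hA : IsRegularSet c₀ r₀ A)
    {u : Feat d → ℝ} (hu : ∀ n : ℕ, ContDiff ℝ n u) (hu01 : ∀ x, u x ∈ Set.Icc (0 : ℝ) 1)
    (hone : ∀ x, ‖x‖ ≤ 1 → u x = 1) (hsupp : tsupport u ⊆ Metric.closedBall 0 2)
    (hM : ∀ k ≤ strictFloor β + 1, ∀ y, ‖iteratedFDeriv ℝ k u y‖ ≤ M)
    {x₀ : Feat d} (hx₀ : x₀ ∈ A) (hρ : 0 < ρ) (hρ₀ : ρ ≤ r₀)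
    (hρA : 1 ≤ K * volume.real (A \ Metric.closedBall x₀ (2 * ρ)))
    (hr : 0 < r) (hr1 : r ≤ 1) (hrρ : 2 * r < ρ)
    (ha : 0 < a) (ha2 : a ≤ 1 / 2) (haL : a * ((strictFloor β + 2) * M) ≤ L)
    (hκ : 0 < κ) (hκ1 : κ ≤ 1) (hκC : κ ≤ C₀)
    (hκK : κ ≤ K * (c₀ * volume.real (Metric.ball (0 : Feat d) 1)) * (c₀ * (ρ / 4) ^ d))
    (hκn : κ ≤ c₀ * (ρ / 4) ^ d / 96) (hn : n * r ^ ((2 + α) * β + d) ≤ 1)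
    {f : (Fin n → Obs d) → Feat d → Fin 2} (hf : IsClassifier f) :
    ((κ / 2 * (a * r ^ β) ^ (1 + α) : ℝ) : EReal)
      ≤ worstExcessRisk (MildClass d α C₀ β L c₀ r₀ K A') f := by
  obtain ⟨F, hFA, hsep, hcard⟩ := hA.exists_packing hAc hc₀ hx₀ hρ hρ₀
    (r := 4 * r) (by positivity)
  set v := volume.real (Metric.ball (0 : Feat d) 1) with hv
  have hvpos : 0 < v := volume_real_unitBall_pos
  set c₁ := c₀ * (ρ / 4) ^ d with hc₁
  have hc₁pos : 0 < c₁ := by positivity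
  set m : ℝ := (F.card : ℝ) with hm
  -- The packing was taken at separation `4 * r`, whence `ρ / 4` in `c₁`.
  have hmc : c₁ ≤ m * r ^ d := by
    rw [mul_pow, ← mul_assoc, mul_comm m, mul_assoc] at hcard
    rw [hc₁, div_pow, mul_div_assoc', div_le_iff₀ (by positivity)]
    linarith
  have hmpos : 0 < m := by
    rcases Nat.eq_zero_or_pos F.card with h | h
    · rw [hm, h, Nat.cast_zero, zero_mul] at hmc
      linarith
    · exact Nat.cast_pos.2 h
  have hrβ : 0 < r ^ β := Real.rpow_pos_of_pos hr β
  have hrβ1 : r ^ β ≤ 1 := Real.rpow_le_one hr.le hr1 hβ.le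
  set b := a * r ^ β with hb
  have hbpos : 0 < b := by positivity
  have hb2 : b ≤ 1 / 2 := by nlinarith
  have hbα : 0 < b ^ α := Real.rpow_pos_of_pos hbpos α
  have hbα1 : b ^ α ≤ 1 := Real.rpow_le_one hbpos.le (by linarith) hα.le
  -- The cell mass is chosen so that the total `m * w` saturates the margin condition up to `κ`.
  set w := κ * b ^ α / m with hw
  have hwpos : 0 < w := by positivity
  have hmw : m * w = κ * b ^ α := by rw [hw]; field_simp
  have hc : ∀ i j : F, i ≠ j → 4 * r < dist (i : Feat d) (j : Feat d) := fun i j hij =>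
    hsep i i.2 j j.2 (Subtype.coe_injective.ne hij)
  have hRdist : ∀ x ∈ A \ Metric.closedBall x₀ (2 * ρ), ∀ j : F, 2 * r < dist x j :=
    fun x hx j => by
      have h1 : 2 * ρ < dist x x₀ := by simpa using hx.2
      have h2 : dist (j : Feat d) x₀ ≤ ρ := (hFA j.2).2
      linarith [dist_triangle x j x₀]
  have hwle : w ≤ K * (c₀ * (r ^ d * v)) := by
    have h1 : w ≤ κ / m := by
      rw [hw]
      gcongr
      exact mul_le_of_le_one_right hκ.le hbα1
    refine h1.trans ?_
    rw [div_le_iff₀ hmpos]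
    calc κ ≤ K * (c₀ * v) * c₁ := hκK
      _ ≤ K * (c₀ * v) * (m * r ^ d) := by gcongr
      _ = _ := by ring
  obtain ⟨Q, hQprob, μ, hμm, hμ0, hμK, hQμ, hQS, hQoff⟩ := hA.exists_marginal hAc hc₀ hK
    (c := fun j : F => (j : Feat d)) (fun j => (hFA j.2).1) hr (by linarith) hc hRdist
    hwpos (by rw [Fintype.card_coe, ← hm, hmw]; exact mul_le_one₀ hκ1 hbα.le hbα1) hwle hρA
  obtain ⟨S, hSdef⟩ : ∃ S : F → Set (Feat d),
      S = fun j : F => A ∩ Metric.closedBall (j : Feat d) r := ⟨_, rfl⟩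
  have hSm : ∀ j, MeasurableSet (S j) := fun j => by
    rw [hSdef]; exact hAc.measurableSet.inter measurableSet_closedBall
  have hS : ∀ i j, i ≠ j → Disjoint (S i) (S j) := fun i j hij => by
    rw [hSdef]; exact disjoint_inter_closedBall hr hc A i j hij
  have hSr : ∀ j : F, S j ⊆ Metric.closedBall (j : Feat d) r := fun j => by
    rw [hSdef]; exact Set.inter_subset_right
  have hSA : ∀ j, S j ⊆ A := fun j => by rw [hSdef]; exact Set.inter_subset_left
  replace hQS : ∀ j, Q.real (S j) = w := fun j => by rw [hSdef]; exact hQS j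
  replace hQoff : Q (A \ Metric.closedBall x₀ (2 * ρ) ∪ ⋃ j, S j)ᶜ = 0 := by
    rw [hSdef]; exact hQoff
  -- The information in the sample is `4 κ n b^(2+α) / m`, where `b^(2+α) ≤ r^((2+α)β)` and `1/m ≤
  -- r^d / c₁`; so `n r^D ≤ 1` leaves `4 κ / c₁ ≤ 1/24`.
  have hnε : n * ((2 * b) ^ 2 * w) ≤ 1 / 24 := by
    have h1 : b ^ 2 * b ^ α ≤ r ^ ((2 + α) * β) := by
      rw [← Real.rpow_natCast, ← Real.rpow_add hbpos, mul_comm (2 + α), Real.rpow_mul hr.le]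
      push_cast
      refine Real.rpow_le_rpow hbpos.le ?_ (by positivity)
      nlinarith
    have h2 : n * (r ^ ((2 + α) * β) * r ^ d) ≤ 1 := by
      rwa [← Real.rpow_natCast r d, ← Real.rpow_add hr]
    have h3 : n * (b ^ 2 * b ^ α) * c₁ ≤ m := by
      calc n * (b ^ 2 * b ^ α) * c₁ ≤ n * r ^ ((2 + α) * β) * (m * r ^ d) := by gcongr
        _ = m * (n * (r ^ ((2 + α) * β) * r ^ d)) := by ring
        _ ≤ m * 1 := by gcongr
        _ = m := mul_one m
    have h4 : n * ((2 * b) ^ 2 * w) = 4 * κ * (n * (b ^ 2 * b ^ α)) / m := by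
      rw [hw]; ring
    rw [h4, div_le_iff₀ hmpos]
    have h5 : 0 ≤ n * (b ^ 2 * b ^ α) := by positivity
    nlinarith [mul_le_mul_of_nonneg_right hκn h5]
  obtain ⟨τ, hτ⟩ := exists_le_excessRisk_cellFun (Q := Q) (ε := 2 * b) hf hSm hS (by positivity)
    (by linarith) hwpos hQS hnε
  refine le_trans (EReal.coe_le_coe_iff.2 ?_) (le_iSup₂_of_le _ ?_ (EReal.coe_le_coe_iff.2 hτ))
  · have h1 : b ^ (1 + α) = b * b ^ α := by rw [Real.rpow_add hbpos, Real.rpow_one]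
    rw [Fintype.card_coe, ← hm, h1]
    have h2 : 2 * b * (m * (w / 4)) = b / 2 * (m * w) := by ring
    rw [h2, hmw]
    exact le_of_eq (by ring)
  · refine ⟨marginAssumption_labelledProb _ _ hS hα hC₀ hbpos (abs_signs τ) hQS ?_,
      regressionHolder_labelledProb (c := fun j : F => (j : Feat d)) _ _ hS hβ hr hbpos.le
        hb2 (fun j => (abs_signs τ j).le) hu hu01 hone hsupp hM ?_ hc hSr hRdist hQoff,
      A, hAA', hAc, hA, ?_, μ, hμm, hμ0, (marginalX_labelledProb _ _).trans hQμ,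
      fun x _ => hμK x⟩
    · rw [Fintype.card_coe, ← hm, hmw]
      gcongr
    · calc _ = a * ((strictFloor β + 2) * M) * r ^ β := by rw [hb]; ring
        _ ≤ L * r ^ β := by gcongr
    · rw [marginalX_labelledProb]
      exact measure_mono_null (Set.compl_subset_compl.2
        (Set.union_subset Set.sdiff_subset (Set.iUnion_subset hSA))) hQoff

end Scale

end PlugIn

/-! ### Choice of the scale, and comparison with the rate `1/n` -/

theorem mainTheorem3 (d : ℕ) (hd : 1 ≤ d) (L β α : ℝ) (hL : 0 < L) (hβ : 0 < β) (hα : 0 < α)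
    (c₀ r₀ C₀ μmax : ℝ) (hc₀ : 0 < c₀) (hr₀ : 0 < r₀) (hC₀ : 0 < C₀) (hμmax : 0 < μmax)
    (K : Set (PlugIn.Feat d)) (hK : IsCompact K)
    (hA : ∃ A ⊆ K, IsCompact A ∧ PlugIn.IsRegularSet c₀ r₀ A ∧
      1 < ENNReal.ofReal μmax * volume A) :
    (∃ C : ℝ, 0 < C ∧ ∀ n : ℕ, 1 ≤ n →
      ∀ f : (Fin n → PlugIn.Obs d) → PlugIn.Feat d → Fin 2, PlugIn.IsClassifier f →
        ((C * (n : ℝ) ^ (-((1 + α) * β / ((2 + α) * β + d))) : ℝ) : EReal)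
          ≤ PlugIn.worstExcessRisk (PlugIn.MildClass d α C₀ β L c₀ r₀ μmax K) f) ∧
    (∀ M : ℝ, ∀ᶠ n : ℕ in atTop,
      ∀ f : (Fin n → PlugIn.Obs d) → PlugIn.Feat d → Fin 2, PlugIn.IsClassifier f →
        ((M / (n : ℝ) : ℝ) : EReal)
          < PlugIn.worstExcessRisk (PlugIn.MildClass d α C₀ β L c₀ r₀ μmax K) f) := by
  have hD : 0 < (2 + α) * β + d := by positivity
  set D := (2 + α) * β + d with hDdef
  have hlower : ∃ C : ℝ, 0 < C ∧ ∀ n : ℕ, 1 ≤ n →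
      ∀ f : (Fin n → PlugIn.Obs d) → PlugIn.Feat d → Fin 2, PlugIn.IsClassifier f →
        ((C * (n : ℝ) ^ (-((1 + α) * β / D)) : ℝ) : EReal)
          ≤ PlugIn.worstExcessRisk (PlugIn.MildClass d α C₀ β L c₀ r₀ μmax K) f := by
    obtain ⟨A, hAK, hAc, hAreg, hAvol⟩ := hA
    have hAne : A.Nonempty := by
      by_contra h
      rw [Set.not_nonempty_iff_eq_empty.1 h] at hAvol
      simp at hAvol
    obtain ⟨x₀, hx₀⟩ := hAne
    obtain ⟨ρ, hρ, hρ₀, hρA⟩ := PlugIn.exists_radius hd hAc hμmax hr₀ hAvol x₀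
    obtain ⟨u, hu, hu01, hone, hsupp⟩ := PlugIn.exists_bump d
    have hcs : HasCompactSupport u := by
      rw [HasCompactSupport, hsupp]; exact isCompact_closedBall _ _
    obtain ⟨M, hMpos, hM⟩ :=
      PlugIn.exists_iteratedFDeriv_bound hu hcs (PlugIn.strictFloor β + 1)
    have hv := PlugIn.volume_real_unitBall_pos (d := d)
    set v := volume.real (Metric.ball (0 : PlugIn.Feat d) 1)
    set H := ((PlugIn.strictFloor β : ℝ) + 2) * M with hH
    have hHpos : 0 < H := by positivity
    -- None of `a`, `κ`, `s` depends on `n`: only the scale `r = s * n ^ (-(1 / D))` does.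
    obtain ⟨a, ha, ha'⟩ : ∃ a, 0 < a ∧ a ≤ min (1 / 2) (L / H) :=
      ⟨_, by positivity, le_rfl⟩
    obtain ⟨κ, hκ, hκ'⟩ : ∃ κ, 0 < κ ∧ κ ≤ min (min 1 C₀)
        (min (μmax * (c₀ * v) * (c₀ * (ρ / 4) ^ d)) (c₀ * (ρ / 4) ^ d / 96)) :=
      ⟨_, by positivity, le_rfl⟩
    obtain ⟨s, hs, hs'⟩ : ∃ s, 0 < s ∧ s ≤ min 1 (ρ / 4) := ⟨_, by positivity, le_rfl⟩
    simp only [le_min_iff] at ha' hκ' hs'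
    refine ⟨κ / 2 * (a * s ^ β) ^ (1 + α), by positivity, fun n hn f hf => ?_⟩
    have hn0 : (0 : ℝ) < n := by exact_mod_cast hn
    have hn1 : (1 : ℝ) ≤ n := by exact_mod_cast hn
    have hnD : 0 < (n : ℝ) ^ (-(1 / D)) := Real.rpow_pos_of_pos hn0 _
    have hnD1 : (n : ℝ) ^ (-(1 / D)) ≤ 1 :=
      Real.rpow_le_one_of_one_le_of_nonpos hn1 (neg_nonpos.2 (by positivity))
    set r := s * (n : ℝ) ^ (-(1 / D)) with hr
    have hrpos : 0 < r := by positivity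
    have hrs : r ≤ s := mul_le_of_le_one_right hs.le hnD1
    have hnr : n * r ^ D ≤ 1 := by
      rw [hr, Real.mul_rpow hs.le hnD.le, ← Real.rpow_mul hn0.le]
      have e : -(1 / D) * D = -1 := by field_simp
      rw [e, Real.rpow_neg_one]
      have : s ^ D ≤ 1 := Real.rpow_le_one hs.le hs'.1 hD.le
      field_simp
      exact this
    have key := PlugIn.le_worstExcessRisk_of_scale (n := n) (L := L) (a := a) (κ := κ) (r := r)
      hβ hα hc₀ hC₀ hμmax hAK hAc hAreg hu hu01 hone hsupp.subset hM hx₀ hρ hρ₀ hρA hrpos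
      (hrs.trans hs'.1) (by linarith) ha ha'.1 ((le_div_iff₀ hHpos).1 ha'.2) hκ hκ'.1.1 hκ'.1.2
      hκ'.2.1 hκ'.2.2 hnr hf
    convert key using 2
    have h1 : a * r ^ β = a * s ^ β * (n : ℝ) ^ (-(1 / D) * β) := by
      rw [hr, Real.mul_rpow hs.le hnD.le, ← Real.rpow_mul hn0.le, mul_assoc]
    rw [h1, Real.mul_rpow (x := a * s ^ β) (by positivity) (by positivity), ← Real.rpow_mul hn0.le,
      mul_assoc]
    congr 3
    ring
  refine ⟨hlower, fun M => ?_⟩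
  obtain ⟨C, hC, hCn⟩ := hlower
  -- The gap to the exponent `1` equals `(β + d) / D`, whatever `α` is.
  have hγ : 0 < 1 - (1 + α) * β / D := by
    have hd0 : (0 : ℝ) ≤ d := Nat.cast_nonneg d
    rw [sub_pos, div_lt_one hD, hDdef]
    nlinarith
  have hlim : Tendsto (fun n : ℕ => (n : ℝ) ^ (1 - (1 + α) * β / D)) atTop atTop :=
    (tendsto_rpow_atTop hγ).comp tendsto_natCast_atTop_atTop
  filter_upwards [hlim.eventually_gt_atTop (M / C), eventually_ge_atTop 1] with n hn hn1 f hf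
  refine lt_of_lt_of_le (EReal.coe_lt_coe_iff.2 ?_) (hCn n hn1 f hf)
  have hn0 : (0 : ℝ) < n := by exact_mod_cast hn1
  rw [div_lt_iff₀ hC, sub_eq_add_neg, Real.rpow_add hn0, Real.rpow_one] at hn
  rw [div_lt_iff₀ hn0]
  linarith
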